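/- Let $\mathbb{K}$ be an algebraically closed field of characteristic zero, $R=\mathbb{K}[x_0,\dots,x_n]$ and $Q=\mathbb{K}[X_0,\dots,X_n]$, where $Q$ acts on $R$ by $X_i=\partial/\partial x_i$. Let $0\neq f\in R_d$ be a form of degree $d$, $I=\mathrm{Ann}_f=\{\alpha\in Q:\alpha(f)=0\}$, and let $A=Q/I=\bigoplus_k A_k$ be the associated standard graded Artinian Gorenstein algebra of socle degree $d$; put $h_k=\dim_{\mathbb{K}}A_k$. For each $k$ fix a basis $\alpha_1,\dots,\alpha_{h_k}$ of $A_k$ and let $\mathrm{hess}^k_f=\det\big(\alpha_i\alpha_j(f)\big)_{i,j}\in R$ be the $k$-th Hessian of $f$. Let $I^{-1}_k=\{g\in R_k:\alpha(g)=0\ \text{for all }\alpha\in I\}$ (this is the space of partial derivatives of $f$ of order $d-k$, and has dimension $h_k$), fix a basis $F_1,\dots,F_{h_k}$ of it, and let $X_k\subseteq\mathbb{P}^{h_k-1}$ be the closure of the image of the rational map $\varphi_k=(F_1:\dots:F_{h_k}):\mathbb{P}^n\dashrightarrow\mathbb{P}^{h_k-1}$ (the polar variety defined by forms of degree $k$).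 For a general point $x\in X_k$ let $T^s_xX_k\subseteq\mathbb{P}^{h_k-1}$ be the $s$-th osculating space, i.e. the linear space spanned by all partial derivatives of order $\le s$ of a local parametrization of $X_k$ at $x$ (equivalently, the smallest linear space containing the $s$-th infinitesimal neighbourhood of $x$ in $X_k$). We say that $T^sX_k$ has the expected dimension if, for a general point $x\in X_k$, $$\dim T^s_xX_k=\min\left\{\binom{n+s}{s}-1,\ h_k-1\right\}.$$ The algebra $A$ has the strong Lefschetz property (SLP) if there is $L\in A_1$ such that $\times L^{s-k}:A_k\to A_s$ has maximal rank for all $0\le k<s$. Then the following assertions are equivalent: 1. $A$ has the SLP; 2. $\mathrm{hess}^k_f\neq0$ for every integer $0\le k\le d/2$; 3. for every positive integer $k<d/2$, the osculating space $T^kX_{d-k}$ has the expected dimension. -/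

import Mathlib

open MvPolynomial
open scoped LinearAlgebra.Projectivization

noncomputable section

namespace Apolar

variable {K : Type*} [Field K] {n : ℕ}

/-- The partial derivative `∂/∂xᵢ` as a `K`-linear endomorphism of `R = K[x₀, …, xₙ]`. -/
def partialEnd (K : Type*) [Field K] {n : ℕ} (i : Fin (n + 1)) :
    Module.End K (MvPolynomial (Fin (n + 1)) K) :=
  ((pderiv i : Derivation K (MvPolynomial (Fin (n + 1)) K) (MvPolynomial (Fin (n + 1)) K)) :
    MvPolynomial (Fin (n + 1)) K →ₗ[K] MvPolynomial (Fin (n + 1)) K)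

theorem partialEnd_commute (i j : Fin (n + 1)) :
    Commute (partialEnd K i) (partialEnd K j) := by
  have h : ⁅(pderiv i : Derivation K (MvPolynomial (Fin (n + 1)) K)
      (MvPolynomial (Fin (n + 1)) K)),
      (pderiv j : Derivation K (MvPolynomial (Fin (n + 1)) K) (MvPolynomial (Fin (n + 1)) K))⁆ =
      0 := by
    apply MvPolynomial.derivation_ext
    intro k
    rw [Derivation.commutator_apply, pderiv_X, pderiv_X]
    simp only [Pi.single_apply]
    split_ifs <;> simp
  refine LinearMap.ext fun p => ?_
  have h2 := congrArg (fun D => D p) h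
  simp only [Derivation.commutator_apply, Derivation.zero_apply, sub_eq_zero] at h2
  exact h2

theorem partialEnd_pow_pairwise (m : Fin (n + 1) → ℕ) :
    ((Finset.univ : Finset (Fin (n + 1))) : Set (Fin (n + 1))).Pairwise
      (Function.onFun Commute fun i => partialEnd K i ^ m i) :=
  fun i _ j _ _ => (partialEnd_commute i j).pow_pow _ _

/-- The differential operator `∂^m = ∏ᵢ (∂/∂xᵢ)^(mᵢ)` of a multi-index `m`. -/
def monomialOp (K : Type*) [Field K] {n : ℕ} (m : Fin (n + 1) →₀ ℕ) :
    Module.End K (MvPolynomial (Fin (n + 1)) K) :=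
  Finset.univ.noncommProd (fun i => partialEnd K i ^ m i) (partialEnd_pow_pairwise m)

theorem monomialOp_zero : monomialOp K (0 : Fin (n + 1) →₀ ℕ) = 1 := by
  unfold monomialOp
  apply Finset.noncommProd_eq_pow_card _ _ _ 1 _ |>.trans (one_pow _)
  intro i _
  simp

theorem monomialOp_add (m m' : Fin (n + 1) →₀ ℕ) :
    monomialOp K (m + m') = monomialOp K m * monomialOp K m' := by
  have h := Finset.noncommProd_mul_distrib (s := Finset.univ)
    (fun i => partialEnd K i ^ m i) (fun i => partialEnd K i ^ m' i)
    (fun i _ j _ _ => (partialEnd_commute i j).pow_pow _ _)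
    (fun i _ j _ _ => (partialEnd_commute i j).pow_pow _ _)
    (fun i _ j _ _ => (partialEnd_commute i j).pow_pow _ _)
  refine Eq.trans ?_ h
  apply Finset.noncommProd_congr rfl
  intro i _
  simp [pow_add]

/-- The action of `Q = K[X₀, …, Xₙ]` on `R = K[x₀, …, xₙ]` by constant coefficient differential
operators, `Xᵢ` acting as `∂/∂xᵢ`. Both rings are realised as `MvPolynomial (Fin (n + 1)) K`. -/
def diffOp : MvPolynomial (Fin (n + 1)) K →ₐ[K] Module.End K (MvPolynomial (Fin (n + 1)) K) :=
  AddMonoidAlgebra.lift K (Module.End K (MvPolynomial (Fin (n + 1)) K)) (Fin (n + 1) →₀ ℕ)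
    { toFun := fun m => monomialOp K m.toAdd
      map_one' := monomialOp_zero
      map_mul' := fun m m' => monomialOp_add m.toAdd m'.toAdd }

theorem diffOp_X (i : Fin (n + 1)) (g : MvPolynomial (Fin (n + 1)) K) :
    diffOp (X i) g = pderiv i g := by
  have h : diffOp (X i : MvPolynomial (Fin (n + 1)) K) = monomialOp K (Finsupp.single i 1) := by
    unfold diffOp X monomial
    erw [AddMonoidAlgebra.lift_single]
    simp
  rw [h]
  have h2 : monomialOp K (Finsupp.single i 1) = partialEnd K i := by
    unfold monomialOp
    refine (Finset.mul_noncommProd_erase Finset.univ (Finset.mem_univ i) _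
      (partialEnd_pow_pairwise (Finsupp.single i 1))).symm.trans ?_
    refine (congrArg (_ * ·) (Finset.noncommProd_eq_pow_card _ _ _ 1 ?_)).trans ?_
    · intro j hj
      simp [Finset.ne_of_mem_erase hj]
    · simp
  rw [h2]
  rfl

/-- `Ann_f = {α ∈ Q ∣ α(f) = 0}`. -/
def Ann (f : MvPolynomial (Fin (n + 1)) K) : Ideal (MvPolynomial (Fin (n + 1)) K) where
  carrier := {α | diffOp α f = 0}
  add_mem' := fun {a b} ha hb => by
    simp only [Set.mem_ofPred_eq] at ha hb ⊢
    simp [ha, hb]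
  zero_mem' := by simp
  smul_mem' := fun c a ha => by
    simp only [Set.mem_ofPred_eq] at ha ⊢
    simp [ha]

/-- The graded piece `A_k` of `A = Q / I`: the image of the forms of degree `k`. -/
def gradedPiece (I : Ideal (MvPolynomial (Fin (n + 1)) K)) (k : ℕ) :
    Submodule K (MvPolynomial (Fin (n + 1)) K ⧸ I) :=
  (homogeneousSubmodule (Fin (n + 1)) K k).map (Ideal.Quotient.mkₐ K I).toLinearMap

/-- The graded piece `(I⁻¹)_k` of the Macaulay inverse system of `I`: the forms of degree `k`
that are annihilated by every element of `I`. -/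
def inverseSystem (I : Ideal (MvPolynomial (Fin (n + 1)) K)) (k : ℕ) :
    Submodule K (MvPolynomial (Fin (n + 1)) K) where
  carrier := {g | g.IsHomogeneous k ∧ ∀ α ∈ I, diffOp α g = 0}
  add_mem' := fun {a b} ha hb => ⟨ha.1.add hb.1, fun α hα => by
    rw [map_add, ha.2 α hα, hb.2 α hα, add_zero]⟩
  zero_mem' := ⟨isHomogeneous_zero _ _ _, fun α _ => map_zero _⟩
  smul_mem' := fun c a ha => ⟨(homogeneousSubmodule (Fin (n + 1)) K k).smul_mem c ha.1,
    fun α hα => by rw [map_smul, ha.2 α hα, smul_zero]⟩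

/-- The strong Lefschetz property of `A = Q / I`: there is `L ∈ A₁` such that every
multiplication map `× L^(s-k) : A_k → A_s`, `0 ≤ k < s`, has maximal rank. -/
def HasSLP (I : Ideal (MvPolynomial (Fin (n + 1)) K)) : Prop :=
  ∃ L ∈ gradedPiece I 1, ∀ k s : ℕ, k < s →
    Module.finrank K ((gradedPiece I k).map (LinearMap.mulLeft K (L ^ (s - k)))) =
      min (Module.finrank K (gradedPiece I k)) (Module.finrank K (gradedPiece I s))

/-- The value `a(f)` for a class `a ∈ A = Q / Ann_f`. -/
def applyClass (f : MvPolynomial (Fin (n + 1)) K) (a : MvPolynomial (Fin (n + 1)) K ⧸ Ann f) :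
    MvPolynomial (Fin (n + 1)) K :=
  Quotient.liftOn' a (fun α => diffOp α f) (fun α β h => by
    have h' : α - β ∈ Ann f := (Submodule.quotientRel_def _).1 h
    have h'' : diffOp (α - β) f = 0 := h'
    rw [map_sub, LinearMap.sub_apply, sub_eq_zero] at h''
    exact h'')

/-- The `k`-th Hessian `hess^k_f = det (αᵢ αⱼ (f))` with respect to a basis `(αᵢ)` of `A_k`,
`A = Q / Ann_f`. -/
def hess {ι : Type*} [Fintype ι] [DecidableEq ι] (f : MvPolynomial (Fin (n + 1)) K) {k : ℕ}
    (α : Module.Basis ι K (gradedPiece (Ann f) k)) : MvPolynomial (Fin (n + 1)) K :=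
  (Matrix.of fun i j => applyClass f
    ((α i : MvPolynomial (Fin (n + 1)) K ⧸ Ann f) * (α j))).det

/-! ### Projective varieties and their osculating spaces -/

section Projective

variable {ι : Type*}

/-- The Zariski closure of a set of points of the projective space `ℙ(K^ι)`: the common zeros of
all forms that vanish on the set. -/
def zariskiClosure (S : Set (ℙ K (ι → K))) : Set (ℙ K (ι → K)) :=
  {x | ∀ (e : ℕ) (g : MvPolynomial ι K), g.IsHomogeneous e →
    (∀ y ∈ S, eval y.rep g = 0) → eval x.rep g = 0}

/-- The homogeneous ideal of a set of points of `ℙ(K^ι)`. -/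
def homogeneousIdeal (S : Set (ℙ K (ι → K))) : Ideal (MvPolynomial ι K) :=
  Ideal.span {g | (∃ e : ℕ, g.IsHomogeneous e) ∧ ∀ y ∈ S, eval y.rep g = 0}

/-- The `s`-th osculating space of the projective variety `S` at the point `x`, as a linear
subspace of `K^ι` (so its projective dimension is its vector space dimension minus one).
It is the intersection of the hyperplanes `∑ⱼ aⱼ Xⱼ = 0` whose equation, restricted to `S`,
vanishes at `x` to order at least `s + 1`, that is, which contain the `s`-th infinitesimal
neighbourhood of `x` in `S`. At a smooth point this is the span of all partial derivatives of
order at most `s` of a local parametrization of `S`. The order of vanishing is measured on the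
affine cone, whose ideal is the homogeneous ideal of `S`, at a vector representing `x`. -/
def osculatingSpace [Fintype ι] (S : Set (ℙ K (ι → K))) (s : ℕ) (x : ℙ K (ι → K)) :
    Submodule K (ι → K) where
  carrier := {v | ∀ a : ι → K,
    ∑ j, C (a j) * X j ∈ homogeneousIdeal S ⊔ RingHom.ker (eval x.rep) ^ (s + 1) →
      ∑ j, a j * v j = 0}
  add_mem' := fun {v w} hv hw a ha => by
    simp [mul_add, Finset.sum_add_distrib, hv a ha, hw a ha]
  zero_mem' := fun a _ => by simp
  smul_mem' := fun c v hv a ha => by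
    simp [mul_left_comm, ← Finset.mul_sum, hv a ha]

/-- `p` holds at a general point of the (irreducible) projective variety `S`, i.e. at all points
of some nonempty Zariski open subset of `S` (which may be taken to be a basic open set). -/
def AtGeneralPoint (S : Set (ℙ K (ι → K))) (p : ℙ K (ι → K) → Prop) : Prop :=
  ∃ (e : ℕ) (g : MvPolynomial ι K), g.IsHomogeneous e ∧ (∃ x ∈ S, eval x.rep g ≠ 0) ∧
    ∀ x ∈ S, eval x.rep g ≠ 0 → p x

/-- The closure of the image of the rational map `ℙⁿ ⇢ ℙ(K^ι)`, `P ↦ (F_j(P))_j`, given by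
forms `F_j` of the same degree. -/
def closedImage (F : ι → MvPolynomial (Fin (n + 1)) K) : Set (ℙ K (ι → K)) :=
  zariskiClosure {x | ∃ (P : ℙ K (Fin (n + 1) → K)) (h : (fun j => eval P.rep (F j)) ≠ 0),
    x = Projectivization.mk K (fun j => eval P.rep (F j)) h}

end Projective

/-- The expected (projective) dimension of the `s`-th osculating space at a general point of the
closed image of a rational map `ℙⁿ ⇢ ℙᴺ`. -/
def expectedDim (n s N : ℕ) : ℕ := min ((n + s).choose s - 1) N

/-- For forms `F₀, …, F_N` on `ℙⁿ`, with `X ⊆ ℙᴺ` the closure of the image of the rational map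
they define: at a general point of `X`, the `s`-th osculating space has the expected
dimension. -/
def HasExpectedOsculatingDim {h : ℕ} (F : Fin h → MvPolynomial (Fin (n + 1)) K) (s : ℕ) : Prop :=
  AtGeneralPoint (closedImage F) fun x =>
    Module.finrank K (osculatingSpace (closedImage F) s x) = expectedDim n s (h - 1) + 1

end Apolar

end

noncomputable section

namespace Apolar

variable {K : Type*} [Field K] {n : ℕ}

/-! ### The apolar action on monomials -/

/-! Everything is expressed through one pointwise condition, `HessNondegenerate f k P`: the bilinear
form `(b, a) ↦ (ba)(f)(P)` on `A_k` has no kernel. It holds exactly where the `k`-th Hessian is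
nonzero (`eval_hess_ne_zero_iff`).

For the Lefschetz property, let `L_P = ∑ Pᵢ Xᵢ`. Iterating Euler's identity, `L_P^e` sends a form
`g` of degree `e` to `e! g(P)`. Applied to `(βγ)(f)`, of degree `d - 2k`, this turns nondegeneracy
at `P` into injectivity of `L_P^(d-2k)` on `A_k` (`hessNondegenerate_iff`). Gorenstein duality and
factorisation of powers give maximal rank for all other pairs of degrees, and one `P` serves all `k`
because a finite product of nonzero polynomials is nonzero.

For the osculating spaces, hyperplane sections of `X_{d-k}` pull back to the forms `γ(f)` with `γ`
of degree `k`. Such a form vanishes at `P` to order `k + 1` iff all `(βγ)(f)` with `β` of degree `k`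
vanish at `P`, so nondegeneracy says that no nonzero hyperplane pulls back to order `k + 1`
(`hessNondegenerate_iff_pullback`). Since `h_{d-k} ≤ binom(n+k, k)`, the expected dimension is that
of the whole ambient space, which likewise says that no nonzero hyperplane vanishes to order `k + 1`
on `X_{d-k}` at its general point.

It remains to compare orders of vanishing upstairs and on the image. Pulling back never lowers the
order. Conversely, in characteristic zero the map is smooth onto its image at a general `P`, so the
order does not rise either (`exists_mem_sup_of_pullback_mem_pow`). Chevalley's theorem
(`exists_lift_point`) lifts a general point of the image to a point where the Hessian is nonzero. -/

theorem diffOp_monomial (m : Fin (n + 1) →₀ ℕ) (c : K) :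
    diffOp (monomial m c) = c • monomialOp K m := by
  unfold diffOp monomial
  erw [AddMonoidAlgebra.lift_single]
  rfl

theorem monomialOp_single_one (i : Fin (n + 1)) :
    monomialOp K (Finsupp.single i 1) = partialEnd K i := by
  refine LinearMap.ext fun g => ?_
  have h := diffOp_X i g
  rw [X, diffOp_monomial, one_smul] at h
  exact h

theorem monomialOp_induction {p : (Fin (n + 1) →₀ ℕ) → Prop} (h0 : p 0)
    (h1 : ∀ i, p (Finsupp.single i 1)) (hadd : ∀ a b, p a → p b → p (a + b)) (m) : p m := by
  induction m using Finsupp.induction_linear with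
  | zero => exact h0
  | add a b ha hb => exact hadd a b ha hb
  | single i a =>
    induction a with
    | zero => simpa using h0
    | succ a ih => rw [Finsupp.single_add]; exact hadd _ _ ih (h1 i)

/-- The truncated exponent `m' - m` is harmless: if some `m i` exceeds `m' i`, its falling
factorial, hence the coefficient, is zero. -/
theorem monomialOp_monomial (m m' : Fin (n + 1) →₀ ℕ) (c : K) :
    monomialOp K m (monomial m' c) =
      monomial (m' - m) (c * ∏ i, ((m' i).descFactorial (m i) : K)) := by
  revert m' c
  induction m using monomialOp_induction with
  | h0 => intro m' c; simp [monomialOp_zero]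
  | h1 i =>
    intro m' c
    rw [monomialOp_single_one]
    refine (pderiv_monomial ..).trans ?_
    rw [Finset.prod_eq_single i]
    · simp
    · intro j _ hj; simp [Finsupp.single_eq_of_ne hj]
    · simp
  | hadd a b ha hb =>
    intro m' c
    rw [add_comm a b, monomialOp_add, Module.End.mul_apply, ha, hb, tsub_tsub, mul_assoc,
      ← Finset.prod_mul_distrib, add_comm b a]
    congr 2
    refine Finset.prod_congr rfl fun i _ => ?_
    norm_cast
    have := Nat.descFactorial_mul_descFactorial (n := m' i) (k := a i) (m := a i + b i) (by simp)
    simp only [add_tsub_cancel_left] at this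
    simp only [Finsupp.tsub_apply, Finsupp.add_apply]
    rw [mul_comm, this]

theorem monomialOp_monomial_of_degree_lt {m m' : Fin (n + 1) →₀ ℕ} (h : m'.degree < m.degree)
    (c : K) : monomialOp K m (monomial m' c) = 0 := by
  rw [monomialOp_monomial]
  obtain ⟨i, hi⟩ : ∃ i, m' i < m i := by
    by_contra! hc
    exact absurd (Finsupp.degree_mono (show m ≤ m' from hc)) (not_le.2 h)
  rw [Finset.prod_eq_zero (Finset.mem_univ i), mul_zero, map_zero]
  rw [Nat.descFactorial_of_lt hi, Nat.cast_zero]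

theorem isHomogeneous_induction {σ : Type*} {k : ℕ} {p : MvPolynomial σ K → Prop}
    (h0 : p 0) (hadd : ∀ a b, p a → p b → p (a + b))
    (hm : ∀ (m : σ →₀ ℕ) (c : K), m.degree = k → p (monomial m c))
    {g : MvPolynomial σ K} (hg : g.IsHomogeneous k) : p g := by
  classical
  rw [g.as_sum]
  refine Finset.sum_induction _ p hadd h0 fun m hm' => hm m _ ?_
  have := hg (mem_support_iff.1 hm')
  rwa [Pi.one_def, ← Finsupp.degree_eq_weight_one] at this

theorem diffOp_isHomogeneous {α g : MvPolynomial (Fin (n + 1)) K} {k m e : ℕ}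
    (hα : α.IsHomogeneous k) (hg : g.IsHomogeneous m) (he : e = m - k) :
    (diffOp α g).IsHomogeneous e := by
  subst he
  refine isHomogeneous_induction (p := fun α => (diffOp α g).IsHomogeneous (m - k)) ?_ ?_ ?_ hα
  · simpa using isHomogeneous_zero _ _ _
  · intro a b ha hb; rw [map_add]; exact ha.add hb
  intro s c hs
  refine isHomogeneous_induction
    (p := fun g => (diffOp (monomial s c) g).IsHomogeneous (m - k)) ?_ ?_ ?_ hg
  · simpa using isHomogeneous_zero _ _ _
  · intro a b ha hb; rw [map_add]; exact ha.add hb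
  intro t c' ht
  rw [diffOp_monomial, LinearMap.smul_apply]
  by_cases hst : s ≤ t
  · rw [monomialOp_monomial, smul_monomial]
    refine isHomogeneous_monomial _ ?_
    have : (t - s + s).degree = t.degree := by rw [tsub_add_cancel_of_le hst]
    rw [map_add] at this
    omega
  · rw [monomialOp_monomial]
    obtain ⟨i, hi⟩ : ∃ i, t i < s i := by
      by_contra! hc
      exact hst hc
    rw [Finset.prod_eq_zero (Finset.mem_univ i)]
    · simpa using isHomogeneous_zero _ _ _
    · rw [Nat.descFactorial_of_lt hi, Nat.cast_zero]

theorem diffOp_eq_zero_of_lt {α g : MvPolynomial (Fin (n + 1)) K} {k m : ℕ}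
    (hα : α.IsHomogeneous k) (hg : g.IsHomogeneous m) (h : m < k) : diffOp α g = 0 := by
  refine isHomogeneous_induction (p := fun α => diffOp α g = 0) ?_ ?_ ?_ hα
  · simp
  · intro a b ha hb; rw [map_add, LinearMap.add_apply, ha, hb, add_zero]
  intro s c hs
  refine isHomogeneous_induction (p := fun g => diffOp (monomial s c) g = 0) ?_ ?_ ?_ hg
  · simp
  · intro a b ha hb; rw [map_add, ha, hb, add_zero]
  intro t c' ht
  rw [diffOp_monomial, LinearMap.smul_apply, monomialOp_monomial_of_degree_lt (by omega),
    smul_zero]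

theorem coeff_zero_diffOp_monomial (m : Fin (n + 1) →₀ ℕ) (c : K)
    (g : MvPolynomial (Fin (n + 1)) K) :
    coeff 0 (diffOp (monomial m c) g) = c * coeff m g * ∏ i, ((m i).factorial : K) := by
  rw [diffOp_monomial, LinearMap.smul_apply, coeff_smul, smul_eq_mul, mul_assoc]
  congr 1
  induction g using MvPolynomial.induction_on' with
  | add p q hp hq => rw [map_add, coeff_add, hp, hq, coeff_add, add_mul]
  | monomial t a =>
    rw [monomialOp_monomial]
    by_cases h : t = m
    · subst h
      simp only [tsub_self, Nat.descFactorial_self, coeff_monomial, if_true]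
    · rw [coeff_monomial m, if_neg h, zero_mul, coeff_monomial]
      split_ifs with h0
      · obtain ⟨i, hi⟩ : ∃ i, t i < m i := by
          by_contra! hc
          exact h (le_antisymm (tsub_eq_zero_iff_le.1 h0) hc)
        rw [Finset.prod_eq_zero (Finset.mem_univ i), mul_zero]
        rw [Nat.descFactorial_of_lt hi, Nat.cast_zero]
      · rfl

theorem prod_factorial_ne_zero [CharZero K] (m : Fin (n + 1) →₀ ℕ) :
    ∏ i, ((m i).factorial : K) ≠ 0 :=
  Finset.prod_ne_zero_iff.2 fun _ _ => Nat.cast_ne_zero.2 (Nat.factorial_ne_zero _)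

/-- A form of degree `k` killed by all differential operators of order `k` vanishes. -/
theorem eq_zero_of_diffOp_eq_zero [CharZero K] {g : MvPolynomial (Fin (n + 1)) K} {k : ℕ}
    (hg : g.IsHomogeneous k) (h : ∀ β : MvPolynomial (Fin (n + 1)) K, β.IsHomogeneous k →
      diffOp β g = 0) : g = 0 := by
  ext m
  by_cases hm : m.degree = k
  · have := coeff_zero_diffOp_monomial m 1 g
    rw [h _ (isHomogeneous_monomial _ hm), coeff_zero, one_mul] at this
    simpa [prod_factorial_ne_zero] using this.symm
  · by_contra hc
    exact hm (by
      have := hg hc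
      rwa [Pi.one_def, ← Finsupp.degree_eq_weight_one] at this)

/-- Every linear functional on the forms of degree `k` is given by an operator of order `k`. -/
theorem exists_diffOp_eq_C [CharZero K] (l : MvPolynomial (Fin (n + 1)) K →ₗ[K] K) (k : ℕ) :
    ∃ α : MvPolynomial (Fin (n + 1)) K, α.IsHomogeneous k ∧
      ∀ g : MvPolynomial (Fin (n + 1)) K, g.IsHomogeneous k → diffOp α g = C (l g) := by
  classical
  -- In degree `k` the operators `∂^m / m!` are dual to the monomials, so the coefficient at `m`
  -- must be `l(x^m) / m!`.
  refine ⟨∑ m ∈ Finset.finsuppAntidiag Finset.univ k,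
    monomial m (l (monomial m 1) / ∏ i, ((m i).factorial : K)), ?_, fun g hg => ?_⟩
  · refine IsHomogeneous.sum _ _ _ fun m hm => isHomogeneous_monomial _ ?_
    rw [Finset.mem_finsuppAntidiag] at hm
    rw [Finsupp.degree_eq_sum]; exact hm.1
  · refine isHomogeneous_induction (p := fun g => diffOp _ g = C (l g)) ?_ ?_ ?_ hg
    · simp
    · intro a b ha hb; rw [map_add, ha, hb, map_add, map_add]
    intro t c ht
    have hmt : t ∈ Finset.finsuppAntidiag Finset.univ k := by
      rw [Finset.mem_finsuppAntidiag, ← Finsupp.degree_eq_sum]; exact ⟨ht, by simp⟩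
    have key : ∀ m ∈ Finset.finsuppAntidiag Finset.univ k,
        diffOp (monomial m (l (monomial m 1) / ∏ i, ((m i).factorial : K))) (monomial t c) =
        if m = t then C (l (monomial t c)) else 0 := by
      intro m hm
      have hm' : m.degree = k := by
        rw [Finset.mem_finsuppAntidiag, ← Finsupp.degree_eq_sum] at hm; exact hm.1
      have h0 := diffOp_isHomogeneous (e := 0)
        (isHomogeneous_monomial (l (monomial m 1) / ∏ i, ((m i).factorial : K)) hm')
        (isHomogeneous_monomial c ht) (by simp)
      rw [← totalDegree_zero_iff_isHomogeneous, totalDegree_eq_zero_iff_eq_C] at h0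
      rw [h0, coeff_zero_diffOp_monomial, coeff_monomial]
      by_cases h : m = t
      · subst h
        rw [if_pos rfl, if_pos rfl, mul_right_comm, div_mul_cancel₀ _ (prod_factorial_ne_zero m)]
        congr 1
        rw [mul_comm, ← smul_eq_mul, ← map_smul, smul_monomial, smul_eq_mul, mul_one]
      · rw [if_neg h, if_neg (Ne.symm h)]; simp
    rw [map_sum, LinearMap.sum_apply, Finset.sum_congr rfl key, Finset.sum_ite_eq', if_pos hmt]

/-! ### Algebraic relations and the Jacobian criterion in characteristic zero -/

section Jacobian

variable {K : Type*} [Field K]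

/-- A nonzero relation of least degree works: it is not constant because the `x i` are independent,
so in characteristic zero its derivative is nonzero of smaller degree and cannot be a relation as
well. -/
theorem exists_separable_relation [CharZero K] {A ι : Type*} [CommRing A] [IsDomain A]
    [Algebra K A] {x : ι → A} (hx : AlgebraicIndependent K x) {a : A}
    (ha : IsAlgebraic (Algebra.adjoin K (Set.range x)) a) :
    ∃ p : Polynomial (MvPolynomial ι K),
      p.eval₂ (aeval x : MvPolynomial ι K →ₐ[K] A).toRingHom a = 0 ∧
      p.derivative.eval₂ (aeval x : MvPolynomial ι K →ₐ[K] A).toRingHom a ≠ 0 := by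
  classical
  set φ : MvPolynomial ι K →+* A := (aeval x : MvPolynomial ι K →ₐ[K] A).toRingHom with hφ
  have hφi : Function.Injective φ := hx
  have h1 : ∃ d : ℕ, ∃ p : Polynomial (MvPolynomial ι K), p.natDegree = d ∧ p ≠ 0 ∧
      p.eval₂ φ a = 0 := by
    have h := mt (hx.option_iff_transcendental a).1 (fun h => h ha)
    rw [AlgebraicIndependent, injective_iff_map_eq_zero] at h
    push Not at h
    obtain ⟨P, hP, hP0⟩ := h
    refine ⟨_, optionEquivLeft K ι P, rfl, by simpa using hP0, ?_⟩
    rw [← hP]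
    have : (Polynomial.eval₂RingHom φ a).comp (optionEquivLeft K ι).toRingEquiv.toRingHom =
        (aeval fun o : Option ι => o.elim a x).toRingHom := by
      refine MvPolynomial.ringHom_ext (fun r => ?_) (fun o => ?_)
      · simp [optionEquivLeft_C, hφ]
      · cases o <;> simp [optionEquivLeft_X_none, optionEquivLeft_X_some, hφ]
    exact DFunLike.congr_fun this P
  obtain ⟨p, hpd, hp0, hp⟩ := Nat.find_spec h1
  refine ⟨p, hp, fun hd => ?_⟩
  have hpos : p.natDegree ≠ 0 := by
    intro h0
    rw [Polynomial.eq_C_of_natDegree_eq_zero h0, Polynomial.eval₂_C] at hp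
    apply hp0
    rw [Polynomial.eq_C_of_natDegree_eq_zero h0, (map_eq_zero_iff φ hφi).1 hp, Polynomial.C_0]
  have hlt := Polynomial.natDegree_derivative_lt hpos
  refine Nat.find_min h1 (hpd ▸ hlt) ⟨_, rfl, ?_, hd⟩
  intro h0
  exact hpos (Polynomial.derivative_eq_zero.1 h0)

/-- The chain rule. Only the uniformity of `c` in the derivation `D` matters later, so its entries
are not identified as partial derivatives. -/
theorem exists_derivation_eval₂ {A ι : Type*} [Fintype ι] [CommRing A] [Algebra K A]
    (x : ι → A) (a : A) (p : Polynomial (MvPolynomial ι K)) :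
    ∃ c : ι → A, ∀ D : Derivation K A A,
      D (p.eval₂ (aeval x : MvPolynomial ι K →ₐ[K] A).toRingHom a) = ∑ j, c j * D (x j) +
        p.derivative.eval₂ (aeval x : MvPolynomial ι K →ₐ[K] A).toRingHom a * D a := by
  classical
  have hq : ∀ q : MvPolynomial ι K, ∃ c : ι → A, ∀ D : Derivation K A A,
      D (aeval x q) = ∑ j, c j * D (x j) := by
    intro q
    induction q using MvPolynomial.induction_on with
    | C r => exact ⟨0, fun D => by simp⟩
    | add p q hp hq =>
      obtain ⟨c, hc⟩ := hp
      obtain ⟨c', hc'⟩ := hq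
      exact ⟨c + c', fun D => by simp [hc, hc', add_mul, Finset.sum_add_distrib]⟩
    | mul_X p i hp =>
      obtain ⟨c, hc⟩ := hp
      refine ⟨fun j => x i * c j + if j = i then aeval x p else 0, fun D => ?_⟩
      simp [hc, add_mul, Finset.sum_add_distrib, Finset.mul_sum, mul_assoc, add_comm]
  induction p using Polynomial.induction_on' with
  | add p q hp hq =>
    obtain ⟨c, hc⟩ := hp
    obtain ⟨c', hc'⟩ := hq
    refine ⟨c + c', fun D => ?_⟩
    rw [Polynomial.eval₂_add, map_add, hc, hc', Polynomial.derivative_add, Polynomial.eval₂_add]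
    simp only [Pi.add_apply, add_mul, Finset.sum_add_distrib]
    ring
  | monomial m q =>
    obtain ⟨c, hc⟩ := hq q
    refine ⟨fun j => a ^ m * c j, fun D => ?_⟩
    rw [Polynomial.eval₂_monomial, Derivation.leibniz, Polynomial.derivative_monomial,
      Polynomial.eval₂_monomial, Derivation.leibniz_pow]
    simp only [mul_assoc, ← Finset.mul_sum, ← hc]
    simp
    ring

/-- The Jacobian matrix of algebraically independent polynomials in characteristic zero has a
right inverse at all points outside some hypersurface. -/
theorem exists_jacobian_rightInverse [CharZero K] {σ ι : Type*} [Fintype σ] [DecidableEq ι]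
    {x : ι → MvPolynomial σ K} (hx : AlgebraicIndependent K x) :
    ∃ δ : MvPolynomial σ K, δ ≠ 0 ∧ ∀ P : σ → K, eval P δ ≠ 0 →
      ∃ w : ι → σ → K, ∀ i l, ∑ j, eval P (pderiv j (x i)) * w l j = if i = l then 1 else 0 := by
  classical
  -- Enlarging to a transcendence basis makes the Jacobian square: the basis has as many elements as
  -- there are variables, and every variable is algebraic over it.
  obtain ⟨u, hxu, hu⟩ := exists_isTranscendenceBasis_superset hx.coe_range
  obtain ⟨e⟩ : Nonempty (σ ≃ u) := by
    have := hu.lift_cardinalMk_eq (IsTranscendenceBasis.mvPolynomial σ K)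
    exact (Cardinal.lift_mk_eq'.1 this).map Equiv.symm
  set y : σ → MvPolynomial σ K := fun j => (e j : MvPolynomial σ K) with hy
  have hyi : AlgebraicIndependent K y := hu.1.comp e e.injective
  have hrange : Set.range y = Set.range (Subtype.val : u → MvPolynomial σ K) := by
    rw [show y = Subtype.val ∘ e from rfl, Set.range_comp, e.range_eq_univ, Set.image_univ]
  have halg : ∀ i : σ, IsAlgebraic (Algebra.adjoin K (Set.range y)) (X i : MvPolynomial σ K) := by
    intro i
    rw [hrange]
    exact hu.isAlgebraic.isAlgebraic _
  choose p hp hp' using fun i => exists_separable_relation hyi (halg i)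
  choose c hc using fun i => exists_derivation_eval₂ y (X i : MvPolynomial σ K) (p i)
  refine ⟨∏ i, (p i).derivative.eval₂ (aeval y : MvPolynomial σ K →ₐ[K] _).toRingHom (X i),
    Finset.prod_ne_zero_iff.2 fun i _ => hp' i, fun P hP => ?_⟩
  rw [map_prod, Finset.prod_ne_zero_iff] at hP
  set ε : σ → K := fun i => eval P
    ((p i).derivative.eval₂ (aeval y : MvPolynomial σ K →ₐ[K] _).toRingHom (X i)) with hε
  -- Applying `∂/∂x_l` to the relation `p i (y, X i) = 0` gives `∑ c_ij ∂_l y_j + ε_i δ_il = 0` at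
  -- `P`, which exhibits an inverse of the Jacobian of `y`.
  have key : Matrix.of (fun i j => - (ε i)⁻¹ * eval P (c i j)) *
      Matrix.of (fun i j => eval P (pderiv j (y i))) = (1 : Matrix σ σ K) := by
    ext i l
    have h := congrArg (eval P) (hc i (pderiv l))
    rw [hp i, map_zero, map_zero, map_add, map_sum, map_mul, pderiv_X] at h
    simp only [map_mul] at h
    rw [Matrix.mul_apply, Matrix.one_apply]
    simp only [Matrix.of_apply, mul_assoc, ← Finset.mul_sum]
    rw [eq_neg_of_add_eq_zero_left h.symm, neg_mul_neg]
    change (ε i)⁻¹ * (ε i * _) = _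
    rw [inv_mul_cancel_left₀ (hP i (Finset.mem_univ i)), Pi.single_apply]
    by_cases h : i = l
    · subst h; simp
    · simp [h]
  have key' := mul_eq_one_comm.1 key
  have hxi : ∀ i, ∃ j, y j = x i := fun i => by
    have : x i ∈ Set.range y := by rw [hrange]; simpa using hxu ⟨i, rfl⟩
    exact this
  choose r hr using hxi
  have hrinj : Function.Injective r := fun i l h => hx.injective (by rw [← hr, ← hr, h])
  refine ⟨fun l j => - (ε j)⁻¹ * eval P (c j (r l)), fun i l => ?_⟩
  have := congrFun (congrFun key' (r i)) (r l)
  rw [Matrix.mul_apply, Matrix.one_apply] at this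
  simp only [Matrix.of_apply, hr, hrinj.eq_iff] at this
  exact this

end Jacobian

/-! ### Orders of vanishing at a point -/

section Order

variable {K : Type*} [Field K] {σ ι κ : Type*}

theorem ker_eval_eq_span (P : σ → K) :
    RingHom.ker (eval P) = Ideal.span (Set.range fun i => X i - C (P i)) := by
  refine le_antisymm (fun p hp => ?_) (Ideal.span_le.2 ?_)
  · set I := Ideal.span (Set.range fun i => X i - C (P i))
    have : (Ideal.Quotient.mk I) = ((Ideal.Quotient.mk I).comp C).comp (eval P) := by
      refine MvPolynomial.ringHom_ext (fun r => by simp) (fun i => ?_)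
      simp only [RingHom.comp_apply, eval_X]
      exact Ideal.Quotient.eq.2 (Ideal.subset_span ⟨i, rfl⟩)
    rw [← Ideal.Quotient.eq_zero_iff_mem, this, RingHom.comp_apply, (RingHom.mem_ker).1 hp,
      map_zero]
  · rintro _ ⟨i, rfl⟩
    simp [RingHom.mem_ker]

theorem X_sub_C_mem_ker_eval (P : σ → K) (i : σ) :
    X i - C (P i) ∈ RingHom.ker (eval P) := by simp [RingHom.mem_ker]

theorem sub_C_eval_mem_ker_eval (P : σ → K) (p : MvPolynomial σ K) :
    p - C (eval P p) ∈ RingHom.ker (eval P) := by simp [RingHom.mem_ker]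

theorem derivation_mem_pow {A : Type*} [CommRing A] [Algebra K A] (D : Derivation K A A)
    (I : Ideal A) (s : ℕ) {p : A} (hp : p ∈ I ^ (s + 1)) : D p ∈ I ^ s := by
  induction s generalizing p with
  | zero => simp
  | succ s ih =>
    rw [pow_succ] at hp
    refine Submodule.mul_induction_on hp (fun a ha b hb => ?_) (fun a b ha hb => ?_)
    · rw [Derivation.leibniz, smul_eq_mul, smul_eq_mul]
      refine add_mem (Ideal.mul_mem_right _ _ ha) ?_
      rw [pow_succ']
      exact Ideal.mul_mem_mul hb (ih ha)
    · rw [map_add]; exact add_mem ha hb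

/-- Being the identity on `m / m²`, `τ` is the identity on each `m^s / m^(s+1)`, by
multiplicativity. -/
theorem algHom_sub_self_mem_pow {τ : MvPolynomial σ K →ₐ[K] MvPolynomial σ K}
    (hτ : ∀ i, τ (X i) - X i ∈ RingHom.ker (eval (0 : σ → K)) ^ 2) (s : ℕ)
    {p : MvPolynomial σ K} (hp : p ∈ RingHom.ker (eval (0 : σ → K)) ^ s) :
    τ p - p ∈ RingHom.ker (eval (0 : σ → K)) ^ (s + 1) := by
  set I := RingHom.ker (eval (0 : σ → K)) with hI
  have hX : ∀ i, (X i : MvPolynomial σ K) ∈ I := fun i => by simp [hI, RingHom.mem_ker]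
  have h0 : ∀ q, τ q - q ∈ I := by
    intro q
    have : (Ideal.Quotient.mkₐ K I).comp τ = Ideal.Quotient.mkₐ K I := by
      ext i
      exact Ideal.Quotient.eq.2 (Ideal.pow_le_self two_ne_zero (hτ i))
    exact Ideal.Quotient.eq.1 (DFunLike.congr_fun this q)
  have hI' : ∀ q ∈ I, τ q ∈ I := fun q hq => by
    have := add_mem (h0 q) hq
    rwa [sub_add_cancel] at this
  have h1 : ∀ b ∈ I, τ b - b ∈ I ^ 2 := by
    intro b hb
    rw [hI, ker_eval_eq_span] at hb
    refine Submodule.span_induction ?_ ?_ ?_ ?_ hb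
    · rintro _ ⟨i, rfl⟩
      simpa using hτ i
    · simp
    · intro a b _ _ ha hb
      rw [map_add, add_sub_add_comm]; exact add_mem ha hb
    · intro c b hb' hb
      have hb' : b ∈ I := by rw [hI, ker_eval_eq_span]; exact hb'
      rw [smul_eq_mul, map_mul, show τ c * τ b - c * b = τ c * (τ b - b) + b * (τ c - c) by ring]
      refine add_mem (Ideal.mul_mem_left _ _ hb) ?_
      rw [pow_two]
      exact Ideal.mul_mem_mul hb' (h0 c)
  induction s generalizing p with
  | zero => simpa using h0 p
  | succ s ih =>
    rw [pow_succ] at hp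
    refine Submodule.mul_induction_on hp (fun a ha b hb => ?_) (fun a b ha hb => ?_)
    · rw [map_mul, show τ a * τ b - a * b = (τ a - a) * τ b + a * (τ b - b) by ring]
      refine add_mem ?_ ?_
      · rw [pow_succ]; exact Ideal.mul_mem_mul (ih ha) (hI' b hb)
      · rw [show s + 1 + 1 = s + 2 from rfl, pow_add]; exact Ideal.mul_mem_mul ha (h1 b hb)
    · rw [map_add, add_sub_add_comm]; exact add_mem ha hb

theorem mem_pow_of_algHom_mem_pow {τ : MvPolynomial σ K →ₐ[K] MvPolynomial σ K}
    (hτ : ∀ i, τ (X i) - X i ∈ RingHom.ker (eval (0 : σ → K)) ^ 2) (N : ℕ)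
    {p : MvPolynomial σ K} (hp : τ p ∈ RingHom.ker (eval (0 : σ → K)) ^ N) :
    p ∈ RingHom.ker (eval (0 : σ → K)) ^ N := by
  have key : ∀ s, s ≤ N → p ∈ RingHom.ker (eval (0 : σ → K)) ^ s := by
    intro s
    induction s with
    | zero => simp
    | succ s ih =>
      intro hs
      have h1 := algHom_sub_self_mem_pow hτ s (ih (by omega))
      exact (Submodule.sub_mem_iff_right _ (Ideal.pow_le_pow_right hs hp)).1 h1
  exact key N le_rfl

variable [Fintype σ]

/-- The Euler derivation centred at `P` fixes the generators of `m`, so by Leibniz it acts on `m^s /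
m^(s+1)` as multiplication by `s`. -/
theorem euler_sub_smul_mem_pow (P : σ → K) (s : ℕ) {p : MvPolynomial σ K}
    (hp : p ∈ RingHom.ker (eval P) ^ s) :
    ∑ i, (X i - C (P i)) * pderiv i p - (s : MvPolynomial σ K) * p ∈
      RingHom.ker (eval P) ^ (s + 1) := by
  classical
  set I := RingHom.ker (eval P) with hI
  set D : Derivation K (MvPolynomial σ K) (MvPolynomial σ K) :=
    ∑ i, (X i - C (P i)) • pderiv i with hD
  have hDa : ∀ p, ∑ i, (X i - C (P i)) * pderiv i p = D p := fun p => by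
    have h := congrFun (map_sum (Derivation.coeFnAddMonoidHom (R := K) (A := MvPolynomial σ K)
      (M := MvPolynomial σ K)) (fun i => (X i - C (P i)) • pderiv i) Finset.univ) p
    rw [Finset.sum_apply] at h
    exact h.symm
  have h1 : ∀ b ∈ I, D b - b ∈ I ^ 2 := by
    intro b hb
    rw [hI, ker_eval_eq_span] at hb
    refine Submodule.span_induction ?_ ?_ ?_ ?_ hb
    · rintro _ ⟨i, rfl⟩
      have : D (X i - C (P i)) = X i - C (P i) := by
        rw [← hDa]
        simp [pderiv_X, Pi.single_apply]
      rw [this, sub_self]; exact zero_mem _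
    · simp
    · intro a b _ _ ha hb
      rw [map_add, add_sub_add_comm]; exact add_mem ha hb
    · intro c b hb' hb
      have hb' : b ∈ I := by rw [hI, ker_eval_eq_span]; exact hb'
      rw [smul_eq_mul, Derivation.leibniz, smul_eq_mul, smul_eq_mul, add_sub_right_comm,
        ← mul_sub]
      refine add_mem (Ideal.mul_mem_left _ _ hb) ?_
      rw [pow_two]
      refine Ideal.mul_mem_mul hb' ?_
      rw [← hDa]
      exact sum_mem fun i _ => Ideal.mul_mem_right _ _ (X_sub_C_mem_ker_eval P i)
  rw [hDa]
  induction s generalizing p with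
  | zero =>
    rw [← hDa, Nat.cast_zero, zero_mul, sub_zero, zero_add, pow_one]
    exact sum_mem fun i _ => Ideal.mul_mem_right _ _ (X_sub_C_mem_ker_eval P i)
  | succ s ih =>
    rw [pow_succ] at hp
    refine Submodule.mul_induction_on hp (fun a ha b hb => ?_) (fun a b ha hb => ?_)
    · have e : D (a * b) - ((s + 1 : ℕ) : MvPolynomial σ K) * (a * b) =
          (D a - (s : MvPolynomial σ K) * a) * b + a * (D b - b) := by
        rw [Derivation.leibniz, smul_eq_mul, smul_eq_mul]
        push_cast; ring
      rw [e]
      refine add_mem ?_ ?_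
      · rw [pow_succ]; exact Ideal.mul_mem_mul (ih ha) hb
      · rw [show s + 1 + 1 = s + 2 from rfl, pow_add]; exact Ideal.mul_mem_mul ha (h1 b hb)
    · rw [map_add, mul_add, add_sub_add_comm]; exact add_mem ha hb

/-- Climb one order at a time: for `p ∈ m^(t+1)` the Euler derivation gives `(t+1) p` modulo
`m^(t+2)`, while the hypothesis puts the same element in `m^(t+2)`; then divide by `t + 1`. -/
theorem mem_pow_succ_of_pderiv_mem [CharZero K] (P : σ → K) (s : ℕ) {p : MvPolynomial σ K}
    (hp : eval P p = 0) (h : ∀ i, pderiv i p ∈ RingHom.ker (eval P) ^ s) :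
    p ∈ RingHom.ker (eval P) ^ (s + 1) := by
  have key : ∀ t, t ≤ s → p ∈ RingHom.ker (eval P) ^ (t + 1) := by
    intro t
    induction t with
    | zero => intro _; simpa [RingHom.mem_ker] using hp
    | succ t ih =>
      intro ht
      have h1 := euler_sub_smul_mem_pow P (t + 1) (ih (by omega))
      have h2 : ∑ i, (X i - C (P i)) * pderiv i p ∈ RingHom.ker (eval P) ^ (t + 1 + 1) := by
        refine sum_mem fun i _ => ?_
        rw [pow_succ']
        exact Ideal.mul_mem_mul (X_sub_C_mem_ker_eval P i) (Ideal.pow_le_pow_right ht (h i))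
      have h3 := (Submodule.sub_mem_iff_right _ h2).1 h1
      have h4 := Ideal.mul_mem_left _ (C ((t + 1 : ℕ) : K)⁻¹) h3
      rwa [← mul_assoc, ← map_natCast (C : K →+* MvPolynomial σ K), ← C_mul,
        inv_mul_cancel₀ (by exact_mod_cast Nat.succ_ne_zero t), C_1, one_mul] at h4
  exact key s le_rfl

theorem sub_linear_mem_sq [CharZero K] (P : σ → K) (p : MvPolynomial σ K) :
    p - C (eval P p) - ∑ j, C (eval P (pderiv j p)) * (X j - C (P j)) ∈
      RingHom.ker (eval P) ^ 2 := by
  classical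
  refine mem_pow_succ_of_pderiv_mem P 1 (by simp) fun i => ?_
  rw [pow_one, RingHom.mem_ker]
  simp [pderiv_X, Pi.single_apply]

end Order

/-! ### Infinitesimal neighbourhoods of a general point in the image of a polynomial map -/

section Image

variable {K : Type*} [Field K] {σ ι κ : Type*}

theorem map_mem_pow {A B : Type*} [CommRing A] [CommRing B] (f : A →+* B) {I : Ideal A}
    {J : Ideal B} (h : ∀ a ∈ I, f a ∈ J) {N : ℕ} {a : A} (ha : a ∈ I ^ N) : f a ∈ J ^ N := by
  have h2 := Ideal.mem_map_of_mem f ha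
  rw [Ideal.map_pow] at h2
  exact Ideal.pow_right_mono (Ideal.map_le_iff_le_comap.2 h) N h2

theorem algHom_mem_ker_eval (f : MvPolynomial σ K →ₐ[K] MvPolynomial κ K) {P : σ → K} {y : κ → K}
    (h : ∀ i, f (X i - C (P i)) ∈ RingHom.ker (eval y)) (a : MvPolynomial σ K)
    (ha : a ∈ RingHom.ker (eval P)) : f a ∈ RingHom.ker (eval y) := by
  rw [ker_eval_eq_span] at ha
  refine (Ideal.span_le (I := (RingHom.ker (eval y)).comap f.toRingHom)).2 ?_ ha
  rintro _ ⟨i, rfl⟩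
  exact h i

theorem eval_aeval_eq (F : κ → MvPolynomial σ K) (P : σ → K) (q : MvPolynomial κ K) :
    eval P (aeval F q) = eval (fun j => eval P (F j)) q := by
  have : ((eval P).comp (aeval F : MvPolynomial κ K →ₐ[K] MvPolynomial σ K).toRingHom) =
      eval fun j => eval P (F j) := MvPolynomial.ringHom_ext (fun c => by simp) (fun i => by simp)
  exact DFunLike.congr_fun this q

/-- At a point of a variety with ideal `I`, the coordinates that are simple roots of polynomial
relations over the coordinates `r i` have their differentials spanned by those of the `r i`. -/
theorem X_sub_C_mem_of_relation {I : Ideal (MvPolynomial κ K)} {x : κ → K}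
    (hI : I ≤ RingHom.ker (eval x)) (r : ι → κ) (j : κ)
    (p : Polynomial (MvPolynomial ι K))
    (hp : p.eval₂ (rename r : MvPolynomial ι K →ₐ[K] _).toRingHom (X j) ∈ I)
    (hp' : eval x
      (p.derivative.eval₂ (rename r : MvPolynomial ι K →ₐ[K] _).toRingHom (X j)) ≠ 0) :
    X j - C (x j) ∈ Ideal.span (Set.range fun i => X (r i) - C (x (r i))) ⊔ I ⊔
      RingHom.ker (eval x) ^ 2 := by
  set T := Ideal.span (Set.range fun i => X (r i) - C (x (r i))) ⊔ I ⊔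
      RingHom.ker (eval x) ^ 2 with hT
  have hIT : I ≤ T := le_sup_right.trans le_sup_left
  set ψ : MvPolynomial ι K →+* MvPolynomial κ K := (rename r : MvPolynomial ι K →ₐ[K] _).toRingHom
    with hψ
  set e : MvPolynomial ι K →+* K := eval (x ∘ r) with he
  have hmk : (Ideal.Quotient.mk T).comp ψ = (algebraMap K (MvPolynomial κ K ⧸ T)).comp e := by
    refine MvPolynomial.ringHom_ext (fun c => ?_) (fun i => ?_)
    · simp [hψ, he]; rfl
    · simp only [hψ, he, RingHom.comp_apply, AlgHom.toRingHom_eq_coe, RingHom.coe_coe, rename_X,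
        eval_X, Function.comp]
      refine Ideal.Quotient.eq.2 ?_
      exact (le_sup_left.trans le_sup_left : _ ≤ T) (Ideal.subset_span ⟨i, rfl⟩)
  have hev : (eval x).comp ψ = e := by
    refine MvPolynomial.ringHom_ext (fun c => by simp [hψ, he]) (fun i => by simp [hψ, he])
  have hmkeval : ∀ q : Polynomial (MvPolynomial ι K),
      Ideal.Quotient.mk T (q.eval₂ ψ (X j)) =
        Polynomial.aeval (Ideal.Quotient.mk T (X j)) (q.map e) := by
    intro q
    rw [Polynomial.hom_eval₂, hmk, Polynomial.aeval_def, Polynomial.eval₂_map]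
  have hevalev : ∀ q : Polynomial (MvPolynomial ι K),
      eval x (q.eval₂ ψ (X j)) = (q.map e).eval (x j) := by
    intro q
    rw [Polynomial.hom_eval₂, hev, eval_X, Polynomial.eval_map]
  -- Modulo `T` the coordinates `X (r i)` are constants and `y² = 0`, so the relation becomes its
  -- first-order Taylor expansion `0 = p(x) + p'(x) y` with `p(x) = 0` and `p'(x)` invertible.
  set y : MvPolynomial κ K ⧸ T := Ideal.Quotient.mk T (X j - C (x j)) with hy
  have hy2 : y ^ 2 = 0 := by
    rw [hy, ← map_pow, Ideal.Quotient.eq_zero_iff_mem]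
    exact (le_sup_right : _ ≤ T) (Ideal.pow_mem_pow (X_sub_C_mem_ker_eval x j) 2)
  have hXj : Ideal.Quotient.mk T (X j) = algebraMap K _ (x j) + y := by
    rw [hy, map_sub]
    exact (add_sub_cancel (algebraMap K (MvPolynomial κ K ⧸ T) (x j)) _).symm
  have h1 := hmkeval p
  rw [Ideal.Quotient.eq_zero_iff_mem.2 (hIT hp), hXj, Polynomial.aeval_add_of_sq_eq_zero _ _ _ hy2,
    Polynomial.aeval_algebraMap_apply, Polynomial.aeval_algebraMap_apply,
    Polynomial.coe_aeval_eq_eval, ← hevalev,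
    (RingHom.mem_ker).1 (hI hp), map_zero, zero_add, Polynomial.derivative_map, ← hevalev] at h1
  rw [← Ideal.Quotient.eq_zero_iff_mem]
  change y = 0
  set c := eval x (p.derivative.eval₂ ψ (X j)) with hc
  calc y = algebraMap K _ c⁻¹ * (algebraMap K _ c * y) := by
        rw [← mul_assoc, ← map_mul, inv_mul_cancel₀ hp', map_one, one_mul]
    _ = 0 := by rw [← h1, mul_zero]

/-- If finitely many elements `t i` generate the cotangent space of `V(I)` at `x`, every
polynomial is a polynomial in the `t i` up to any given order. -/
theorem exists_aeval_sub_mem {I : Ideal (MvPolynomial κ K)} {x : κ → K}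
    {t : ι → MvPolynomial κ K} (ht : ∀ i, t i ∈ RingHom.ker (eval x))
    (hm : RingHom.ker (eval x) ≤ Ideal.span (Set.range t) ⊔ I ⊔ RingHom.ker (eval x) ^ 2)
    (N : ℕ) (p : MvPolynomial κ K) :
    ∃ q : MvPolynomial ι K, p - aeval t q ∈ I ⊔ RingHom.ker (eval x) ^ N := by
  set m := RingHom.ker (eval x) with hmdef
  set m0 := RingHom.ker (eval (0 : ι → K)) with hm0
  have hX0 : ∀ i, (X i : MvPolynomial ι K) ∈ m0 := fun i => by simp [hm0, RingHom.mem_ker]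
  have htm : ∀ q ∈ m0, aeval t q ∈ m := algHom_mem_ker_eval _ fun i => by
    rw [Pi.zero_apply, C_0, sub_zero, aeval_X]; exact ht i
  have htms : ∀ s, ∀ q ∈ m0 ^ s, aeval t q ∈ m ^ s := fun s q hq =>
    map_mem_pow (aeval t : MvPolynomial ι K →ₐ[K] MvPolynomial κ K).toRingHom htm hq
  have hone : ∀ p ∈ m, ∃ q ∈ m0, p - aeval t q ∈ I ⊔ m ^ 2 := by
    intro p hp
    have hp := hm hp
    rw [sup_assoc] at hp
    obtain ⟨a, ha, b, hb, rfl⟩ := Submodule.mem_sup.1 hp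
    suffices h : ∃ q ∈ m0, a - aeval t q ∈ I ⊔ m ^ 2 by
      obtain ⟨q, hq, h⟩ := h
      exact ⟨q, hq, by rw [add_sub_right_comm]; exact add_mem h hb⟩
    refine Submodule.span_induction ?_ ?_ ?_ ?_ ha
    · rintro _ ⟨i, rfl⟩
      exact ⟨X i, hX0 i, by simp⟩
    · exact ⟨0, zero_mem _, by simp⟩
    · rintro a b _ _ ⟨q, hq, h⟩ ⟨q', hq', h'⟩
      exact ⟨q + q', add_mem hq hq', by rw [map_add, add_sub_add_comm]; exact add_mem h h'⟩
    · rintro c a _ ⟨q, hq, h⟩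
      -- A coefficient `c` may be replaced by its value at `x`, since the error `(c - c(x)) · aeval
      -- t q` lies in `m²`.
      refine ⟨C (eval x c) * q, Ideal.mul_mem_left _ _ hq, ?_⟩
      have e : c • a - aeval t (C (eval x c) * q) =
          c * (a - aeval t q) + (c - C (eval x c)) * aeval t q := by
        rw [map_mul, aeval_C, smul_eq_mul]
        change _ - C (eval x c) * _ = _
        ring
      rw [e]
      refine add_mem (Ideal.mul_mem_left _ _ h) (Ideal.mem_sup_right ?_)
      rw [pow_two]
      exact Ideal.mul_mem_mul (sub_C_eval_mem_ker_eval x c) (htm q hq)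
  -- Products of first-order approximations approximate `m^s` modulo `I + m^(s+1)`; successive
  -- corrections then reach any order.
  have hstep : ∀ s, ∀ p ∈ m ^ s, ∃ q ∈ m0 ^ s, p - aeval t q ∈ I ⊔ m ^ (s + 1) := by
    intro s
    induction s with
    | zero =>
      intro p _
      refine ⟨C (eval x p), by simp, Ideal.mem_sup_right ?_⟩
      rw [aeval_C, zero_add, pow_one]
      exact sub_C_eval_mem_ker_eval x p
    | succ s ih =>
      intro p hp
      rw [pow_succ] at hp
      refine Submodule.mul_induction_on hp (fun a ha b hb => ?_) ?_
      · obtain ⟨q, hq, h⟩ := ih a ha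
        obtain ⟨q', hq', h'⟩ := hone b hb
        refine ⟨q * q', by rw [pow_succ]; exact Ideal.mul_mem_mul hq hq', ?_⟩
        rw [map_mul, show a * b - aeval t q * aeval t q' = (a - aeval t q) * b +
          aeval t q * (b - aeval t q') by ring]
        obtain ⟨u, hu, v, hv, huv⟩ := Submodule.mem_sup.1 h
        obtain ⟨u', hu', v', hv', huv'⟩ := Submodule.mem_sup.1 h'
        rw [← huv, ← huv', add_mul, mul_add]
        refine add_mem (add_mem (Ideal.mem_sup_left (Ideal.mul_mem_right _ _ hu))
          (Ideal.mem_sup_right ?_)) (add_mem (Ideal.mem_sup_left (Ideal.mul_mem_left _ _ hu'))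
          (Ideal.mem_sup_right ?_))
        · rw [pow_succ]; exact Ideal.mul_mem_mul hv hb
        · rw [show s + 1 + 1 = s + 2 from rfl, pow_add]
          exact Ideal.mul_mem_mul (htms s q hq) hv'
      · rintro a b ⟨q, hq, h⟩ ⟨q', hq', h'⟩
        exact ⟨q + q', add_mem hq hq', by rw [map_add, add_sub_add_comm]; exact add_mem h h'⟩
  induction N with
  | zero => exact ⟨0, by simp⟩
  | succ N ih =>
    obtain ⟨q, hq⟩ := ih
    obtain ⟨u, hu, v, hv, huv⟩ := Submodule.mem_sup.1 hq
    obtain ⟨q', -, hq'⟩ := hstep N v hv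
    refine ⟨q + q', ?_⟩
    rw [map_add, ← sub_sub, ← huv, add_sub_assoc]
    exact add_mem (Ideal.mem_sup_left hu) hq'

/-- Polynomials `F (r i)` with linearly independent differentials at `P` satisfy no relation up to
any order at `P`. -/
theorem mem_pow_of_aeval_aeval_mem_pow [CharZero K] [Fintype σ] [Fintype ι] [DecidableEq ι]
    (F : κ → MvPolynomial σ K) (r : ι → κ) (P : σ → K) (w : ι → σ → K)
    (hw : ∀ i l, ∑ j, eval P (pderiv j (F (r i))) * w l j = if i = l then 1 else 0) (N : ℕ)
    (q : MvPolynomial ι K)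
    (hq : aeval F (aeval (fun i => (X (r i) - C (eval P (F (r i))) : MvPolynomial κ K)) q) ∈
      RingHom.ker (eval P) ^ N) :
    q ∈ RingHom.ker (eval (0 : ι → K)) ^ N := by
  set m0 := RingHom.ker (eval (0 : ι → K)) with hm0
  set t : ι → MvPolynomial κ K := fun i => X (r i) - C (eval P (F (r i))) with ht
  -- restrict to the affine slice through `P` spanned by the rows of `w`
  set ψ : MvPolynomial σ K →ₐ[K] MvPolynomial ι K :=
    aeval fun j => C (P j) + ∑ i, C (w i j) * X i with hψ
  have hψm : ∀ (M : ℕ) (g : MvPolynomial σ K), g ∈ RingHom.ker (eval P) ^ M → ψ g ∈ m0 ^ M :=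
    fun M g hg => map_mem_pow ψ.toRingHom
      (algHom_mem_ker_eval ψ fun j => by simp [hψ, RingHom.mem_ker]) hg
  have h1 : ∀ c : K, ψ (C c) = C c := fun c => ψ.commutes c
  set τ : MvPolynomial ι K →ₐ[K] MvPolynomial ι K := (ψ.comp (aeval F)).comp (aeval t) with hτdef
  -- By `hw`, the function `F (r i) - F (r i)(P)` restricts on the slice to `X i` plus terms of
  -- order two, so `τ` is the identity modulo `m0²` and reflects the order of vanishing.
  refine mem_pow_of_algHom_mem_pow (τ := τ) (fun i => ?_) N (hψm N _ hq)
  have h := hψm 2 _ (sub_linear_mem_sq P (F (r i)))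
  have h2 : ∀ j, ψ (X j - C (P j)) = ∑ l, C (w l j) * X l := fun j => by
    rw [map_sub, h1]; simp [hψ]
  have h3 : ψ (∑ j, C (eval P (pderiv j (F (r i)))) * (X j - C (P j))) = X i := by
    simp only [map_sum, map_mul ψ, h1, h2, Finset.mul_sum, ← mul_assoc]
    rw [Finset.sum_comm]
    simp only [← C_mul, ← Finset.sum_mul, ← map_sum, hw i]
    simp
  have h4 : τ (X i) = ψ (F (r i)) - C (eval P (F (r i))) := by
    simp only [hτdef, AlgHom.comp_apply, aeval_X, ht, map_sub, ← h1]
    congr 2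
    exact (aeval F : MvPolynomial κ K →ₐ[K] MvPolynomial σ K).commutes _
  rwa [map_sub, map_sub, h3, h1, ← h4] at h

/-- A finite family contains an algebraically independent subfamily over which all its members
are algebraic. -/
theorem exists_algebraicIndepOn_isAlgebraic [Finite κ] {A : Type*} [CommRing A] [IsDomain A]
    [Algebra K A] (F : κ → A) :
    ∃ s : Set κ, AlgebraicIndepOn K F s ∧
      ∀ j, IsAlgebraic (Algebra.adjoin K (Set.range fun i : s => F i)) (F j) := by
  classical
  have hne : {s : Set κ | AlgebraicIndepOn K F s}.Nonempty :=
    ⟨∅, (algebraicIndependent_empty_type_iff ..).2 (algebraMap K _).injective⟩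
  obtain ⟨s, hs⟩ := (Set.toFinite {s : Set κ | AlgebraicIndepOn K F s}).exists_maximal hne
  refine ⟨s, hs.prop, fun j => ?_⟩
  by_contra hj
  have hind := (AlgebraicIndependent.option_iff_transcendental hs.prop (F j)).2 hj
  have hjs : j ∉ s := by
    intro hjs
    have := hind.injective (a₁ := none) (a₂ := some ⟨j, hjs⟩) rfl
    simp at this
  have hins : AlgebraicIndepOn K F (insert j s) := by
    let g : ↥(insert j s) → Option s := fun i => if h : (i : κ) ∈ s then some ⟨i, h⟩ else none
    have hg : Function.Injective g := by
      rintro ⟨a, ha⟩ ⟨b, hb⟩ hab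
      by_cases h1 : a ∈ s <;> by_cases h2 : b ∈ s <;> simp [g, h1, h2] at hab
      · exact Subtype.ext hab
      · have h1' : a = j := ha.resolve_right h1
        have h2' : b = j := hb.resolve_right h2
        exact Subtype.ext (h1'.trans h2'.symm)
    have := hind.comp g hg
    convert this using 1
    funext ⟨a, ha⟩
    by_cases h1 : a ∈ s
    · simp [g, h1]
    · have h1' : a = j := ha.resolve_right h1
      simp [g, h1, ← h1']
  exact hjs (hs.le_of_ge hins (Set.subset_insert j s) (Set.mem_insert j s))

theorem aeval_eval₂_rename (F : κ → MvPolynomial σ K) (r : ι → κ)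
    (q : Polynomial (MvPolynomial ι K)) (j : κ) :
    aeval F (q.eval₂ (rename r : MvPolynomial ι K →ₐ[K] MvPolynomial κ K).toRingHom (X j)) =
      q.eval₂ (aeval (fun i => F (r i)) : MvPolynomial ι K →ₐ[K] _).toRingHom (F j) := by
  have h := Polynomial.hom_eval₂ q
    (rename r : MvPolynomial ι K →ₐ[K] MvPolynomial κ K).toRingHom
    (aeval F : MvPolynomial κ K →ₐ[K] MvPolynomial σ K).toRingHom (X j)
  refine h.trans ?_
  congr 1
  · exact MvPolynomial.ringHom_ext (fun c => by simp) (fun i => by simp)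
  · simp

/-- For a polynomial map `F` and a point `P` outside some hypersurface, a polynomial on the
target whose pullback vanishes to order `N` at `P` vanishes to order `N` at `F P` on the image
of `F`. -/
theorem exists_mem_sup_of_pullback_mem_pow [CharZero K] [Fintype σ] [Finite κ]
    (F : κ → MvPolynomial σ K) :
    ∃ δ : MvPolynomial σ K, δ ≠ 0 ∧ ∀ P : σ → K, eval P δ ≠ 0 →
      ∀ (N : ℕ) (p : MvPolynomial κ K), aeval F p ∈ RingHom.ker (eval P) ^ N →
        p ∈ RingHom.ker (aeval F : MvPolynomial κ K →ₐ[K] MvPolynomial σ K) ⊔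
          RingHom.ker (eval fun j => eval P (F j)) ^ N := by
  classical
  cases nonempty_fintype κ
  obtain ⟨s, hs, halg⟩ := exists_algebraicIndepOn_isAlgebraic (K := K) F
  choose p hp hp' using fun j => exists_separable_relation hs (halg j)
  obtain ⟨δ, hδ, hδP⟩ := exists_jacobian_rightInverse hs
  -- Away from this product the `F i`, `i ∈ s`, have independent differentials at `P`, and every
  -- coordinate is a simple root of its relation over them, so the `X i - x i` with `i ∈ s` generate
  -- the cotangent space of the image.
  refine ⟨δ * ∏ j, (p j).derivative.eval₂
    (aeval (fun i : s => F i) : MvPolynomial s K →ₐ[K] _).toRingHom (F j),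
    mul_ne_zero hδ (Finset.prod_ne_zero_iff.2 fun j _ => hp' j), fun P hP N l hl => ?_⟩
  rw [map_mul, map_prod] at hP
  have hP2 := Finset.prod_ne_zero_iff.1 (right_ne_zero_of_mul hP)
  obtain ⟨w, hw⟩ := hδP P (left_ne_zero_of_mul hP)
  set x : κ → K := fun j => eval P (F j) with hx
  set I := RingHom.ker (aeval F : MvPolynomial κ K →ₐ[K] MvPolynomial σ K) with hI
  have hIx : I ≤ RingHom.ker (eval x) := fun q hq => by
    rw [RingHom.mem_ker, ← eval_aeval_eq, (RingHom.mem_ker).1 hq, map_zero]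
  set t : s → MvPolynomial κ K := fun i => X (i : κ) - C (x i) with ht
  have hm : RingHom.ker (eval x) ≤ Ideal.span (Set.range t) ⊔ I ⊔ RingHom.ker (eval x) ^ 2 := by
    conv_lhs => rw [ker_eval_eq_span]
    rw [Ideal.span_le]
    rintro _ ⟨j, rfl⟩
    refine X_sub_C_mem_of_relation hIx Subtype.val j (p j) ?_ ?_
    · rw [hI, RingHom.mem_ker]; exact (aeval_eval₂_rename F _ _ _).trans (hp j)
    · rw [← eval_aeval_eq, aeval_eval₂_rename]; exact hP2 j (Finset.mem_univ j)
  have htx : ∀ i, t i ∈ RingHom.ker (eval x) := fun i => X_sub_C_mem_ker_eval x (i : κ)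
  -- Modulo `I + m_x^N`, `l` is a polynomial `q` in the local coordinates `t`. Its pullback still
  -- vanishes to order `N` at `P`, and independence of the differentials passes this order on to `q`
  -- itself.
  obtain ⟨q, hq⟩ := exists_aeval_sub_mem (I := I) (x := x) (t := t) htx hm N l
  have hqN : q ∈ RingHom.ker (eval (0 : s → K)) ^ N := by
    refine mem_pow_of_aeval_aeval_mem_pow F Subtype.val P w hw N q ?_
    obtain ⟨u, hu, v, hv, huv⟩ := Submodule.mem_sup.1 hq
    have e : aeval t q = l - (u + v) := by rw [huv]; ring
    have hv' : aeval F v ∈ RingHom.ker (eval P) ^ N :=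
      map_mem_pow (aeval F : MvPolynomial κ K →ₐ[K] MvPolynomial σ K).toRingHom
        (algHom_mem_ker_eval _ fun j => by simp [hx, RingHom.mem_ker]) hv
    have hu' : aeval F u = 0 := (RingHom.mem_ker).1 hu
    change aeval F (aeval t q) ∈ _
    rw [e, map_sub, map_add, hu', zero_add]
    exact sub_mem hl hv'
  have hres : aeval t q ∈ RingHom.ker (eval x) ^ N :=
    map_mem_pow (aeval t : MvPolynomial s K →ₐ[K] MvPolynomial κ K).toRingHom
      (algHom_mem_ker_eval _ fun i => by simp [ht, RingHom.mem_ker]) hqN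
  have := add_mem hq (Ideal.mem_sup_right (S := I) hres)
  rwa [sub_add_cancel] at this

end Image

/-! ### The apolar algebra: Hessians and the strong Lefschetz property -/

section Lefschetz

variable {K : Type*} [Field K] {n : ℕ}

theorem mem_Ann {f α : MvPolynomial (Fin (n + 1)) K} : α ∈ Ann f ↔ diffOp α f = 0 := Iff.rfl

theorem exists_eval_ne_zero {σ : Type*} [Infinite K] {g : MvPolynomial σ K} (hg : g ≠ 0) :
    ∃ P : σ → K, eval P g ≠ 0 := by
  by_contra! h
  exact hg (MvPolynomial.funext fun P => by rw [h P, map_zero])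

theorem homogeneousSubmodule_eq_span (k : ℕ) :
    homogeneousSubmodule (Fin (n + 1)) K k =
      Submodule.span K (Set.range fun m :
          Finset.finsuppAntidiag (Finset.univ : Finset (Fin (n + 1))) k =>
        (monomial m (1 : K) : MvPolynomial (Fin (n + 1)) K)) := by
  refine le_antisymm (fun g hg => ?_) (Submodule.span_le.2 ?_)
  · refine isHomogeneous_induction (p := fun g => g ∈ Submodule.span K _) (zero_mem _)
      (fun _ _ => add_mem) (fun m c hm => ?_) hg
    rw [← mul_one c, ← smul_eq_mul, ← smul_monomial]
    refine Submodule.smul_mem _ _ (Submodule.subset_span ⟨⟨m, ?_⟩, rfl⟩)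
    simp [Finset.mem_finsuppAntidiag, ← hm, Finsupp.degree_eq_sum]
  · rintro _ ⟨⟨m, hm⟩, rfl⟩
    rw [Finset.mem_finsuppAntidiag] at hm
    exact isHomogeneous_monomial _ (by rw [Finsupp.degree_eq_sum]; exact hm.1)

instance homogeneousSubmodule_finite (k : ℕ) :
    Module.Finite K (homogeneousSubmodule (Fin (n + 1)) K k) := by
  rw [homogeneousSubmodule_eq_span]
  exact Module.Finite.span_of_finite K (Set.finite_range _)

theorem finrank_homogeneousSubmodule_le (k : ℕ) :
    Module.finrank K (homogeneousSubmodule (Fin (n + 1)) K k) ≤ (n + k).choose k := by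
  rw [homogeneousSubmodule_eq_span]
  refine (finrank_range_le_card _).trans ?_
  rw [Fintype.card_coe, Finset.card_finsuppAntidiag_nat_eq_choose]
  simp [Nat.add_right_comm]

instance gradedPiece_finite (I : Ideal (MvPolynomial (Fin (n + 1)) K)) (k : ℕ) :
    Module.Finite K (gradedPiece I k) := by
  unfold gradedPiece; infer_instance

theorem mem_gradedPiece {I : Ideal (MvPolynomial (Fin (n + 1)) K)} {k : ℕ}
    {a : MvPolynomial (Fin (n + 1)) K ⧸ I} :
    a ∈ gradedPiece I k ↔
      ∃ γ : MvPolynomial (Fin (n + 1)) K, γ.IsHomogeneous k ∧ Ideal.Quotient.mk I γ = a :=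
  Iff.rfl

theorem mk_mem_gradedPiece (I : Ideal (MvPolynomial (Fin (n + 1)) K)) {k : ℕ}
    {γ : MvPolynomial (Fin (n + 1)) K} (h : γ.IsHomogeneous k) :
    Ideal.Quotient.mk I γ ∈ gradedPiece I k := mem_gradedPiece.2 ⟨γ, h, rfl⟩

theorem mul_mem_gradedPiece {I : Ideal (MvPolynomial (Fin (n + 1)) K)} {k l : ℕ}
    {a b : MvPolynomial (Fin (n + 1)) K ⧸ I} (ha : a ∈ gradedPiece I k)
    (hb : b ∈ gradedPiece I l) : a * b ∈ gradedPiece I (k + l) := by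
  obtain ⟨α, hα, rfl⟩ := mem_gradedPiece.1 ha
  obtain ⟨β, hβ, rfl⟩ := mem_gradedPiece.1 hb
  rw [← map_mul]
  exact mk_mem_gradedPiece I (hα.mul hβ)

theorem pow_mem_gradedPiece {I : Ideal (MvPolynomial (Fin (n + 1)) K)} {a : _ ⧸ I}
    (ha : a ∈ gradedPiece I 1) (e : ℕ) : a ^ e ∈ gradedPiece I e := by
  obtain ⟨α, hα, rfl⟩ := mem_gradedPiece.1 ha
  rw [← map_pow]
  exact mk_mem_gradedPiece I (by simpa using hα.pow e)

/-- The map `a ↦ a(f)` as a linear map on `A = Q / Ann_f`. -/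
def applyHom (f : MvPolynomial (Fin (n + 1)) K) :
    (MvPolynomial (Fin (n + 1)) K ⧸ Ann f) →ₗ[K] MvPolynomial (Fin (n + 1)) K where
  toFun := applyClass f
  map_add' a b := by
    obtain ⟨α, rfl⟩ := Ideal.Quotient.mk_surjective a
    obtain ⟨β, rfl⟩ := Ideal.Quotient.mk_surjective b
    change diffOp (α + β) f = diffOp α f + diffOp β f
    rw [map_add, LinearMap.add_apply]
  map_smul' c a := by
    obtain ⟨α, rfl⟩ := Ideal.Quotient.mk_surjective a
    change diffOp (c • α) f = c • diffOp α f
    rw [map_smul, LinearMap.smul_apply]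

theorem applyHom_mk (f α : MvPolynomial (Fin (n + 1)) K) :
    applyHom f (Ideal.Quotient.mk _ α) = diffOp α f := rfl

theorem diffOp_mul (α β g : MvPolynomial (Fin (n + 1)) K) :
    diffOp (α * β) g = diffOp α (diffOp β g) := by
  rw [map_mul, Module.End.mul_apply]

/-- The specialisation at `P` of the `k`-th Hessian matrix of `f` is nondegenerate. -/
def HessNondegenerate (f : MvPolynomial (Fin (n + 1)) K) (k : ℕ) (P : Fin (n + 1) → K) : Prop :=
  ∀ a ∈ gradedPiece (Ann f) k, (∀ b ∈ gradedPiece (Ann f) k, eval P (applyHom f (b * a)) = 0) →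
    a = 0

theorem eval_hess_ne_zero_iff {ι : Type*} [Fintype ι] [DecidableEq ι]
    (f : MvPolynomial (Fin (n + 1)) K) {k : ℕ} (α : Module.Basis ι K (gradedPiece (Ann f) k))
    (P : Fin (n + 1) → K) : eval P (hess f α) ≠ 0 ↔ HessNondegenerate f k P := by
  set M : Matrix ι ι K := Matrix.of fun i j => eval P (applyHom f ((α i : _ ⧸ Ann f) * α j))
    with hM
  have hdet : eval P (hess f α) = M.det := by
    rw [hess, RingHom.map_det]; rfl
  have hmul : ∀ (v : ι → K) (i : ι),
      (M.mulVec v) i = eval P (applyHom f ((α i : _ ⧸ Ann f) * (∑ j, v j • α j : gradedPiece _ k)))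
      := by
    intro v i
    rw [Matrix.mulVec, dotProduct]
    simp only [hM, Matrix.of_apply, Submodule.coe_sum, Submodule.coe_smul, Finset.mul_sum,
      mul_smul_comm, map_sum, map_smul, smul_eval, mul_comm (v _)]
  rw [hdet, Ne, ← Matrix.exists_mulVec_eq_zero_iff]
  push Not
  constructor
  · intro h a ha hab
    have hrepr := α.sum_repr ⟨a, ha⟩
    have h0 : M.mulVec (α.repr ⟨a, ha⟩) = 0 := by
      funext i
      rw [hmul, hrepr]
      exact hab _ (α i).2
    by_contra hne
    refine h _ (fun hv => hne ?_) h0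
    have : (⟨a, ha⟩ : gradedPiece (Ann f) k) = 0 := by
      rw [← hrepr]; simp [hv]
    exact congrArg Subtype.val this
  · intro h v hv hMv
    apply hv
    have h0 := h _ (∑ j, v j • α j : gradedPiece (Ann f) k).2 (fun b hb => by
      have hrepr := α.sum_repr ⟨b, hb⟩
      have : b = ((∑ i, α.repr ⟨b, hb⟩ i • α i : gradedPiece (Ann f) k) : _ ⧸ Ann f) := by
        rw [hrepr]
      rw [this]
      conv_lhs => rw [Submodule.coe_sum, Finset.sum_mul, map_sum, map_sum]
      refine Finset.sum_eq_zero fun i _ => ?_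
      rw [Submodule.coe_smul, smul_mul_assoc, map_smul, smul_eval, ← hmul, hMv, Pi.zero_apply,
        mul_zero])
    have h1 := Fintype.linearIndependent_iff.1 α.linearIndependent v (Subtype.ext h0)
    exact _root_.funext h1

/-- The linear form `∑ Pᵢ Xᵢ`. -/
def linForm (P : Fin (n + 1) → K) : MvPolynomial (Fin (n + 1)) K := ∑ i, C (P i) * X i

theorem linForm_isHomogeneous (P : Fin (n + 1) → K) : (linForm P).IsHomogeneous 1 :=
  IsHomogeneous.sum _ _ _ fun i _ => by
    simpa using (isHomogeneous_C _ (P i)).mul (isHomogeneous_X K i)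

theorem exists_eq_linForm {g : MvPolynomial (Fin (n + 1)) K} (hg : g.IsHomogeneous 1) :
    ∃ P, g = linForm P := by
  refine isHomogeneous_induction (p := fun g => ∃ P, g = linForm P) ⟨0, by simp [linForm]⟩ ?_ ?_ hg
  · rintro _ _ ⟨P, rfl⟩ ⟨P', rfl⟩
    exact ⟨P + P', by simp [linForm, add_mul, Finset.sum_add_distrib]⟩
  · intro m c hm
    obtain ⟨i, rfl⟩ := (Finsupp.sum_eq_one_iff m).1 hm
    refine ⟨Pi.single i c, ?_⟩
    rw [linForm, Finset.sum_eq_single i]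
    · rw [Pi.single_eq_same, C_mul_X_eq_monomial]
    · intro j _ hj; rw [Pi.single_eq_of_ne hj, C_0, zero_mul]
    · simp

theorem diffOp_linForm (P : Fin (n + 1) → K) (g : MvPolynomial (Fin (n + 1)) K) :
    diffOp (linForm P) g = ∑ i, C (P i) * pderiv i g := by
  rw [linForm, map_sum, LinearMap.sum_apply]
  refine Finset.sum_congr rfl fun i _ => ?_
  rw [← smul_eq_C_mul, map_smul, LinearMap.smul_apply, diffOp_X, smul_eq_C_mul]

theorem IsHomogeneous.sum_mul_eval_pderiv {g : MvPolynomial (Fin (n + 1)) K} {e : ℕ}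
    (hg : g.IsHomogeneous e) (P : Fin (n + 1) → K) :
    ∑ i, P i * eval P (pderiv i g) = e * eval P g := by
  have := congrArg (eval P) hg.sum_X_mul_pderiv
  simpa using this

/-- Each application of `linForm P` multiplies the value at `P` by the current degree, by Euler's
identity. This is the bridge between evaluation at `P` and multiplication by a linear form. -/
theorem diffOp_linForm_pow (P : Fin (n + 1) → K) {e : ℕ} {g : MvPolynomial (Fin (n + 1)) K}
    (hg : g.IsHomogeneous e) : diffOp (linForm P ^ e) g = C (e.factorial * eval P g) := by
  induction e generalizing g with
  | zero =>
    rw [← totalDegree_zero_iff_isHomogeneous, totalDegree_eq_zero_iff_eq_C] at hg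
    rw [hg]; simp
  | succ e ih =>
    have h1 : (diffOp (linForm P) g).IsHomogeneous e :=
      diffOp_isHomogeneous (linForm_isHomogeneous P) hg (by simp)
    rw [pow_succ, diffOp_mul, ih h1, diffOp_linForm]
    simp only [map_sum, map_mul (eval P), eval_C]
    rw [IsHomogeneous.sum_mul_eval_pderiv hg, Nat.factorial_succ]
    congr 1
    push_cast; ring

section CharZero

variable [CharZero K] {f : MvPolynomial (Fin (n + 1)) K} {d : ℕ}

/-- The Hessian matrix at `P` represents multiplication by a power of the linear form of `P`. -/
theorem hessNondegenerate_iff (hf : f.IsHomogeneous d) {k : ℕ} (hk : 2 * k ≤ d)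
    (P : Fin (n + 1) → K) :
    HessNondegenerate f k P ↔ ∀ a ∈ gradedPiece (Ann f) k,
      Ideal.Quotient.mk (Ann f) (linForm P) ^ (d - 2 * k) * a = 0 → a = 0 := by
  refine forall_congr' fun a => forall_congr' fun ha => imp_congr_left ?_
  obtain ⟨γ, hγ, rfl⟩ := mem_gradedPiece.1 ha
  have hpow : (linForm P ^ (d - 2 * k)).IsHomogeneous (d - 2 * k) := by
    simpa using (linForm_isHomogeneous P).pow (d - 2 * k)
  have key : ∀ β : MvPolynomial (Fin (n + 1)) K, β.IsHomogeneous k →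
      diffOp β (diffOp (linForm P ^ (d - 2 * k) * γ) f) =
        C ((d - 2 * k).factorial * eval P (diffOp (β * γ) f)) := by
    intro β hβ
    have h1 : (diffOp (β * γ) f).IsHomogeneous (d - 2 * k) :=
      diffOp_isHomogeneous (hβ.mul hγ) hf (by omega)
    rw [← diffOp_linForm_pow P h1, ← diffOp_mul, ← diffOp_mul]
    congr 2
    ring
  have hfac : ((d - 2 * k).factorial : K) ≠ 0 := Nat.cast_ne_zero.2 (Nat.factorial_ne_zero _)
  rw [← map_pow, ← map_mul, Ideal.Quotient.eq_zero_iff_mem, mem_Ann]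
  constructor
  · intro h
    refine eq_zero_of_diffOp_eq_zero (k := k)
      (diffOp_isHomogeneous (hpow.mul hγ) hf (by omega)) fun β hβ => ?_
    have := h _ (mk_mem_gradedPiece _ hβ)
    rw [← map_mul, applyHom_mk] at this
    rw [key β hβ, this, mul_zero, C_0]
  · intro h b hb
    obtain ⟨β, hβ, rfl⟩ := mem_gradedPiece.1 hb
    rw [← map_mul, applyHom_mk]
    have := key β hβ
    rw [h, map_zero, eq_comm, C_eq_zero] at this
    exact (mul_eq_zero.1 this).resolve_left hfac

/-- The pairing `(a, b) ↦ (ab)(f) ∈ K` of complementary degrees has no left kernel, since a form of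
degree `l` killed by all operators of order `l` is zero. -/
theorem finrank_gradedPiece_le (hf : f.IsHomogeneous d) {k l : ℕ} (hkl : k + l = d) :
    Module.finrank K (gradedPiece (Ann f) k) ≤ Module.finrank K (gradedPiece (Ann f) l) := by
  rw [← Subspace.dual_finrank_eq (V := gradedPiece (Ann f) l)]
  let B : gradedPiece (Ann f) k →ₗ[K] Module.Dual K (gradedPiece (Ann f) l) :=
    LinearMap.mk₂ K (fun a b => coeff 0 (applyHom f ((a : _ ⧸ Ann f) * b)))
      (fun a b c => by simp [add_mul]) (fun c a b => by
        rw [Submodule.coe_smul, smul_mul_assoc, map_smul, coeff_smul])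
      (fun a b c => by simp [mul_add]) (fun c a b => by
        rw [Submodule.coe_smul, mul_smul_comm, map_smul, coeff_smul])
  refine LinearMap.finrank_le_finrank_of_injective (f := B) ?_
  rw [injective_iff_map_eq_zero]
  rintro ⟨a, ha⟩ h
  obtain ⟨γ, hγ, rfl⟩ := mem_gradedPiece.1 ha
  refine Subtype.ext ?_
  change Ideal.Quotient.mk _ γ = 0
  rw [Ideal.Quotient.eq_zero_iff_mem, mem_Ann]
  refine eq_zero_of_diffOp_eq_zero (k := l) (diffOp_isHomogeneous hγ hf (by omega)) fun β hβ => ?_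
  have h1 := LinearMap.congr_fun h ⟨_, mk_mem_gradedPiece (Ann f) hβ⟩
  change coeff 0 (applyHom f (Ideal.Quotient.mk _ γ * Ideal.Quotient.mk _ β)) = 0 at h1
  rw [← map_mul, applyHom_mk, mul_comm, diffOp_mul] at h1
  have h2 := diffOp_isHomogeneous (e := 0) hβ
    (diffOp_isHomogeneous (e := l) hγ hf (by omega)) (by omega)
  rw [← totalDegree_zero_iff_isHomogeneous, totalDegree_eq_zero_iff_eq_C] at h2
  rw [h2, h1, C_0]

theorem finrank_gradedPiece_symm (hf : f.IsHomogeneous d) {k l : ℕ} (hkl : k + l = d) :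
    Module.finrank K (gradedPiece (Ann f) k) = Module.finrank K (gradedPiece (Ann f) l) :=
  le_antisymm (finrank_gradedPiece_le hf hkl) (finrank_gradedPiece_le hf (by omega))

end CharZero

theorem gradedPiece_eq_bot {f : MvPolynomial (Fin (n + 1)) K} {d : ℕ} (hf : f.IsHomogeneous d)
    {s : ℕ} (hs : d < s) : gradedPiece (Ann f) s = ⊥ := by
  rw [eq_bot_iff]
  intro a ha
  obtain ⟨γ, hγ, rfl⟩ := mem_gradedPiece.1 ha
  rw [Submodule.mem_bot, Ideal.Quotient.eq_zero_iff_mem, mem_Ann]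
  exact diffOp_eq_zero_of_lt hγ hf hs

theorem finrank_map_eq_iff {V W : Type*} [AddCommGroup V] [Module K V] [AddCommGroup W]
    [Module K W] (T : V →ₗ[K] W) (M : Submodule K V) [Module.Finite K M] :
    Module.finrank K (M.map T) = Module.finrank K M ↔ ∀ a ∈ M, T a = 0 → a = 0 := by
  have h := (T.domRestrict M).finrank_range_add_finrank_ker
  rw [LinearMap.range_domRestrict] at h
  have h0 : Module.finrank K (LinearMap.ker (T.domRestrict M)) = 0 ↔
      ∀ a ∈ M, T a = 0 → a = 0 := by
    rw [Submodule.finrank_eq_zero, LinearMap.ker_eq_bot']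
    constructor
    · intro h a ha hT
      exact congrArg Subtype.val (h ⟨a, ha⟩ hT)
    · rintro h ⟨a, ha⟩ hT
      exact Subtype.ext (h a ha hT)
  rw [← h0]
  omega

theorem map_mulLeft_pow_le {I : Ideal (MvPolynomial (Fin (n + 1)) K)} {a : _ ⧸ I}
    (ha : a ∈ gradedPiece I 1) {k e s : ℕ} (h : e + k = s) :
    (gradedPiece I k).map (LinearMap.mulLeft K (a ^ e)) ≤ gradedPiece I s := by
  rintro _ ⟨b, hb, rfl⟩
  rw [← h]
  exact mul_mem_gradedPiece (pow_mem_gradedPiece ha e) hb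

theorem hasSLP_iff [CharZero K] {f : MvPolynomial (Fin (n + 1)) K} {d : ℕ}
    (hf : f.IsHomogeneous d) :
    HasSLP (Ann f) ↔ ∃ P, ∀ k, 2 * k ≤ d → HessNondegenerate f k P := by
  constructor
  · rintro ⟨L, hL, hmax⟩
    obtain ⟨g, hg, rfl⟩ := mem_gradedPiece.1 hL
    obtain ⟨P, rfl⟩ := exists_eq_linForm hg
    refine ⟨P, fun k hk => (hessNondegenerate_iff hf hk P).2 ?_⟩
    rcases hk.eq_or_lt with rfl | hlt
    · intro a _ h; simpa using h
    · have h1 := hmax k (d - k) (by omega)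
      rw [finrank_gradedPiece_symm hf (show d - k + k = d by omega), min_self,
        finrank_map_eq_iff] at h1
      rwa [show d - 2 * k = d - k - k by omega]
  · rintro ⟨P, hP⟩
    set L := Ideal.Quotient.mk (Ann f) (linForm P) with hLdef
    have hL : L ∈ gradedPiece (Ann f) 1 := mk_mem_gradedPiece _ (linForm_isHomogeneous P)
    refine ⟨L, hL, fun k s hks => ?_⟩
    have hle := map_mulLeft_pow_le hL (show s - k + k = s by omega)
    have hfin := Submodule.finrank_mono hle
    rcases lt_or_ge d s with hs | hs
    · have h0 : Module.finrank K (gradedPiece (Ann f) s) = 0 := by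
        rw [gradedPiece_eq_bot hf hs, finrank_bot]
      omega
    -- If `k + s ≤ d`, then `L^(s-k)` is a factor of the injective `L^(d-2k)`. Otherwise the
    -- injection `L^(2s-d) : A_{d-s} → A_s` is onto by equality of dimensions and factors through
    -- `A_k`, so `L^(s-k)` is onto.
    rcases le_or_gt (k + s) d with hsum | hsum
    · have h1 := (finrank_map_eq_iff (LinearMap.mulLeft K (L ^ (s - k)))
        (gradedPiece (Ann f) k)).2 (fun a ha h0 => by
          refine (hessNondegenerate_iff hf (by omega) P).1 (hP k (by omega)) a ha ?_
          rw [← hLdef, show d - 2 * k = (d - s - k) + (s - k) by omega, pow_add, mul_assoc]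
          rw [LinearMap.mulLeft_apply] at h0
          rw [h0, mul_zero])
      rw [h1] at hfin ⊢
      exact (min_eq_left hfin).symm
    · have h1 := (finrank_map_eq_iff (LinearMap.mulLeft K (L ^ (s - (d - s))))
        (gradedPiece (Ann f) (d - s))).2 (fun a ha h0 => by
          refine (hessNondegenerate_iff hf (by omega) P).1 (hP (d - s) (by omega)) a ha ?_
          rwa [← hLdef, show d - 2 * (d - s) = s - (d - s) by omega])
      rw [finrank_gradedPiece_symm hf (show d - s + s = d by omega)] at h1
      have h2 : (gradedPiece (Ann f) (d - s)).map (LinearMap.mulLeft K (L ^ (s - (d - s)))) ≤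
          (gradedPiece (Ann f) k).map (LinearMap.mulLeft K (L ^ (s - k))) := by
        rintro _ ⟨a, ha, rfl⟩
        refine ⟨L ^ (k - (d - s)) * a, ?_, ?_⟩
        · have := mul_mem_gradedPiece (pow_mem_gradedPiece hL (k - (d - s))) ha
          rwa [show k - (d - s) + (d - s) = k by omega] at this
        · rw [LinearMap.mulLeft_apply, LinearMap.mulLeft_apply, ← mul_assoc, ← pow_add]
          congr 2
          omega
      have h3 := Submodule.finrank_mono h2
      have h4 := Submodule.finrank_map_le (LinearMap.mulLeft K (L ^ (s - k)))
        (gradedPiece (Ann f) k)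
      omega

theorem hessNondegenerate_zero [CharZero K] {f : MvPolynomial (Fin (n + 1)) K}
    {P : Fin (n + 1) → K} (hP : eval P f ≠ 0) : HessNondegenerate f 0 P := by
  intro a ha h
  obtain ⟨γ, hγ, rfl⟩ := mem_gradedPiece.1 ha
  have h1 := h _ (mk_mem_gradedPiece _ (isHomogeneous_one _ _))
  rw [map_one, one_mul, applyHom_mk] at h1
  rw [← totalDegree_zero_iff_isHomogeneous, totalDegree_eq_zero_iff_eq_C] at hγ
  rw [hγ] at h1 ⊢
  have h2 : diffOp (C (coeff 0 γ) : MvPolynomial (Fin (n + 1)) K) f = coeff 0 γ • f := by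
    rw [← algebraMap_eq, AlgHom.commutes]; rfl
  rw [h2, smul_eval] at h1
  rw [(mul_eq_zero.1 h1).resolve_right hP, C_0, map_zero]

/-- In the middle degree the relevant power of the linear form is the zeroth, so injectivity is
automatic. -/
theorem hessNondegenerate_half [CharZero K] {f : MvPolynomial (Fin (n + 1)) K} {d : ℕ}
    (hf : f.IsHomogeneous d) {k : ℕ} (hk : 2 * k = d) (P : Fin (n + 1) → K) :
    HessNondegenerate f k P := by
  refine (hessNondegenerate_iff hf hk.le P).2 fun a _ h => ?_
  rwa [hk, Nat.sub_self, pow_zero, one_mul] at h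

theorem exists_forall_hessNondegenerate_iff [CharZero K] {f : MvPolynomial (Fin (n + 1)) K}
    {d : ℕ} (α : ∀ k : ℕ, Module.Basis (Fin (Module.finrank K (gradedPiece (Ann f) k))) K
      (gradedPiece (Ann f) k)) :
    (∃ P, ∀ k, 2 * k ≤ d → HessNondegenerate f k P) ↔ ∀ k, 2 * k ≤ d → hess f (α k) ≠ 0 := by
  constructor
  · rintro ⟨P, hP⟩ k hk h0
    exact (eval_hess_ne_zero_iff f (α k) P).2 (hP k hk) (by rw [h0, map_zero])
  · intro h
    have h1 : ∏ k ∈ (Finset.range (d + 1)).filter (fun k => 2 * k ≤ d), hess f (α k) ≠ 0 :=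
      Finset.prod_ne_zero_iff.2 fun k hk => h k (Finset.mem_filter.1 hk).2
    obtain ⟨P, hP⟩ := exists_eval_ne_zero h1
    rw [map_prod, Finset.prod_ne_zero_iff] at hP
    refine ⟨P, fun k hk => (eval_hess_ne_zero_iff f (α k) P).1 (hP k ?_)⟩
    simp only [Finset.mem_filter, Finset.mem_range]
    omega

end Lefschetz

/-! ### The closed image of a rational map -/

section ClosedImage

variable {K : Type*} [Field K]

/-- The image of the complement of a hypersurface under a polynomial map contains a nonempty open
subset of the closure of the image. -/
theorem exists_lift_point [IsAlgClosed K] {σ κ : Type*} [Finite σ] [Finite κ]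
    (F : κ → MvPolynomial σ K) {c : MvPolynomial σ K} (hc : c ≠ 0) :
    ∃ g : MvPolynomial κ K, aeval F g ≠ 0 ∧ ∀ v : κ → K,
      (∀ q : MvPolynomial κ K, aeval F q = 0 → eval v q = 0) → eval v g ≠ 0 →
        ∃ P : σ → K, (∀ j, eval P (F j) = v j) ∧ eval P c ≠ 0 := by
  set φ : MvPolynomial κ K →+* MvPolynomial σ K :=
    (aeval F : MvPolynomial κ K →ₐ[K] MvPolynomial σ K).toRingHom with hφ
  have hft : φ.FiniteType := by
    refine RingHom.FiniteType.of_comp_finiteType (f := (C : K →+* MvPolynomial κ K)) ?_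
    have : φ.comp C = algebraMap K (MvPolynomial σ K) := by
      ext1 r; simp [hφ]
    rw [this, RingHom.finiteType_algebraMap]
    infer_instance
  -- By Chevalley the image of `D(c)` is constructible. It contains the image of the generic point,
  -- so one of its locally closed pieces does too, and that piece is open in the closure of the
  -- image.
  have hcons := PrimeSpectrum.isConstructible_comap_image
    (RingHom.FinitePresentation.of_finiteType.1 hft)
    (PrimeSpectrum.isConstructible_basicOpen (f := c))
  obtain ⟨S, hS⟩ := PrimeSpectrum.exists_constructibleSetData_iff.2 hcons
  have hgen : PrimeSpectrum.comap φ ⊥ ∈ S.toSet := by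
    rw [hS]
    exact ⟨⊥, by simpa [PrimeSpectrum.mem_basicOpen] using hc, rfl⟩
  simp only [PrimeSpectrum.ConstructibleSetData.toSet, Set.mem_iUnion] at hgen
  obtain ⟨B, hB, hgB, hfB⟩ := hgen
  refine ⟨B.f, ?_, fun v hv hvB => ?_⟩
  · intro h0
    apply hfB
    rw [PrimeSpectrum.mem_zeroLocus, Set.singleton_subset_iff]
    simpa [hφ] using h0
  · have hprime : (RingHom.ker (eval v)).IsPrime := RingHom.ker_isPrime _
    have hmem : (⟨RingHom.ker (eval v), hprime⟩ : PrimeSpectrum (MvPolynomial κ K)) ∈ S.toSet := by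
      simp only [PrimeSpectrum.ConstructibleSetData.toSet, Set.mem_iUnion]
      refine ⟨B, hB, ?_, ?_⟩
      · rw [PrimeSpectrum.mem_zeroLocus]
        intro q hq
        refine hv q ?_
        have := (PrimeSpectrum.mem_zeroLocus _ _).1 hgB hq
        simpa [hφ] using this
      · rw [PrimeSpectrum.mem_zeroLocus, Set.singleton_subset_iff]
        exact hvB
    rw [hS] at hmem
    obtain ⟨q, hq, hqv⟩ := hmem
    have hq' : c ∉ q.asIdeal := hq
    -- The prime `q` over `v` need not be maximal; the Nullstellensatz supplies a closed point of
    -- `V(q)` at which `c` is nonzero, and it still maps to `v`.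
    rw [← IsPrime.vanishingIdeal_zeroLocus (K := K) q.asIdeal, mem_vanishingIdeal_iff] at hq'
    push Not at hq'
    obtain ⟨P, hP, hPc⟩ := hq'
    refine ⟨P, fun j => ?_, by simpa [aeval_eq_eval] using hPc⟩
    have h1 : X j - C (v j) ∈ (PrimeSpectrum.comap φ q).asIdeal := by
      rw [hqv]; exact X_sub_C_mem_ker_eval v j
    have h2 : φ (X j - C (v j)) ∈ q.asIdeal := h1
    have h3 := hP _ h2
    simpa [hφ, sub_eq_zero, aeval_eq_eval] using h3

theorem eval_smul_of_isHomogeneous {κ : Type*} {g : MvPolynomial κ K} {m : ℕ}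
    (hg : g.IsHomogeneous m) (c : K) (v : κ → K) : eval (c • v) g = c ^ m * eval v g := by
  refine isHomogeneous_induction (p := fun g => eval (c • v) g = c ^ m * eval v g) (by simp)
    (fun a b ha hb => by rw [map_add, map_add, ha, hb, mul_add]) (fun t r ht => ?_) hg
  rw [eval_monomial, eval_monomial, Finsupp.prod, Finsupp.prod]
  simp only [Pi.smul_apply, smul_eq_mul, mul_pow, Finset.prod_mul_distrib]
  rw [Finset.prod_pow_eq_pow_sum, ← ht, Finsupp.degree_apply]
  ring

theorem exists_ne_zero_eval_smul_ne_zero [Infinite K] {κ : Type*} {g : MvPolynomial κ K} {m : ℕ}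
    {v : κ → K} (h : eval v (homogeneousComponent m g) ≠ 0) :
    ∃ c : K, c ≠ 0 ∧ eval (c • v) g ≠ 0 := by
  classical
  set p : Polynomial K := ∑ i ∈ Finset.range (g.totalDegree + 1),
    Polynomial.C (eval v (homogeneousComponent i g)) * Polynomial.X ^ i with hp
  have hpe : ∀ c : K, p.eval c = eval (c • v) g := by
    intro c
    conv_rhs => rw [← sum_homogeneousComponent g]
    rw [hp, Polynomial.eval_finsetSum, map_sum]
    refine Finset.sum_congr rfl fun i _ => ?_
    rw [eval_smul_of_isHomogeneous (homogeneousComponent_isHomogeneous i g)]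
    rw [Polynomial.eval_mul, Polynomial.eval_C, Polynomial.eval_pow, Polynomial.eval_X, mul_comm]
  have hm : m ∈ Finset.range (g.totalDegree + 1) := by
    by_contra hm
    rw [Finset.mem_range, not_lt] at hm
    exact h (by rw [homogeneousComponent_eq_zero _ _ (by omega), map_zero])
  have hp0 : p ≠ 0 := by
    intro h0
    have := congrArg (Polynomial.coeff · m) h0
    simp only [hp, Polynomial.finsetSum_coeff, Polynomial.coeff_C_mul, Polynomial.coeff_X_pow,
      mul_ite, mul_one, mul_zero, Polynomial.coeff_zero] at this
    rw [Finset.sum_ite_eq, if_pos hm] at this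
    exact h this
  by_contra! hc
  -- The factor `X` absorbs the excluded value `c = 0`.
  refine mul_ne_zero hp0 Polynomial.X_ne_zero (Polynomial.funext fun c => ?_)
  rw [Polynomial.eval_mul, Polynomial.eval_X, Polynomial.eval_zero]
  by_cases h0 : c = 0
  · rw [h0, mul_zero]
  · rw [hpe, hc c h0, zero_mul]

/-- Components of different degrees `i` pull back to forms of different degrees `e * i`, as `e > 0`,
so they cannot cancel. -/
theorem aeval_homogeneousComponent_eq_zero {σ κ : Type*} {F : κ → MvPolynomial σ K} {e : ℕ}
    (he : 0 < e) (hF : ∀ j, (F j).IsHomogeneous e) {g : MvPolynomial κ K} (hg : aeval F g = 0)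
    (m : ℕ) : aeval F (homogeneousComponent m g) = 0 := by
  have hhom : ∀ i, (aeval F (homogeneousComponent i g)).IsHomogeneous (e * i) := fun i =>
    (homogeneousComponent_isHomogeneous i g).aeval F hF
  by_cases hm : m ∈ Finset.range (g.totalDegree + 1)
  · have h1 : homogeneousComponent (e * m) (aeval F g) = aeval F (homogeneousComponent m g) := by
      conv_lhs => rw [← sum_homogeneousComponent g, map_sum, map_sum]
      rw [Finset.sum_eq_single m]
      · rw [homogeneousComponent_of_mem (hhom m), if_pos rfl]
      · intro i _ hi
        rw [homogeneousComponent_of_mem (hhom i), if_neg]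
        exact fun h => hi (Nat.eq_of_mul_eq_mul_left he h).symm
      · exact fun h => absurd hm h
    rw [← h1, hg, map_zero]
  · rw [Finset.mem_range, not_lt] at hm
    rw [homogeneousComponent_eq_zero _ _ (by omega), map_zero]

variable {n : ℕ} {κ : Type*} {F : κ → MvPolynomial (Fin (n + 1)) K} {e : ℕ}

theorem ne_zero_of_eval_ne_zero (he : 0 < e) {g : MvPolynomial (Fin (n + 1)) K}
    (hg : g.IsHomogeneous e) {p : Fin (n + 1) → K} (hp : eval p g ≠ 0) : p ≠ 0 := by
  rintro rfl
  have := eval_smul_of_isHomogeneous hg 0 (0 : Fin (n + 1) → K)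
  rw [zero_smul, zero_pow he.ne', zero_mul] at this
  exact hp this

theorem mk_mem_closedImage (he : 0 < e) (hF : ∀ j, (F j).IsHomogeneous e) {p : Fin (n + 1) → K}
    (hp : (fun j => eval p (F j)) ≠ 0) :
    Projectivization.mk K (fun j => eval p (F j)) hp ∈ closedImage F := by
  intro m g hg h
  obtain ⟨j, hj⟩ := Function.ne_iff.1 hp
  have hp0 : p ≠ 0 := ne_zero_of_eval_ne_zero he (hF j) hj
  obtain ⟨a, ha⟩ := Projectivization.exists_smul_eq_mk_rep K p hp0
  have hrep : (fun j => eval (Projectivization.mk K p hp0).rep (F j)) =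
      (a : K) ^ e • fun j => eval p (F j) := by
    funext j
    rw [← ha]
    exact eval_smul_of_isHomogeneous (hF j) a p
  have hne : (fun j => eval (Projectivization.mk K p hp0).rep (F j)) ≠ 0 := by
    rw [hrep]; exact smul_ne_zero (pow_ne_zero _ a.ne_zero) hp
  have h1 := h _ ⟨_, hne, rfl⟩
  have h2 : Projectivization.mk K _ hne = Projectivization.mk K (fun j => eval p (F j)) hp := by
    rw [Projectivization.mk_eq_mk_iff']
    exact ⟨(a : K) ^ e, hrep.symm⟩
  rwa [h2] at h1

theorem aeval_eq_zero_of_vanish_closedImage [Infinite K] (he : 0 < e)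
    (hF : ∀ j, (F j).IsHomogeneous e) {j₀ : κ} (hj₀ : F j₀ ≠ 0) {m : ℕ} {q : MvPolynomial κ K}
    (hq : q.IsHomogeneous m) (h : ∀ x ∈ closedImage F, eval x.rep q = 0) : aeval F q = 0 := by
  -- The factor `F j₀` takes care of the base points, where the rational map is undefined and the
  -- hypothesis says nothing.
  have key : aeval F q * F j₀ = 0 := by
    refine MvPolynomial.funext fun p => ?_
    rw [map_zero, map_mul, eval_aeval_eq]
    by_cases hp : eval p (F j₀) = 0
    · rw [hp, mul_zero]
    have hne : (fun j => eval p (F j)) ≠ 0 := fun h0 => hp (congrFun h0 j₀)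
    obtain ⟨b, hb⟩ := Projectivization.exists_smul_eq_mk_rep K _ hne
    have h1 := h _ (mk_mem_closedImage he hF hne)
    rw [← hb, Units.smul_def, eval_smul_of_isHomogeneous hq] at h1
    rw [(mul_eq_zero.1 h1).resolve_left (pow_ne_zero _ b.ne_zero), zero_mul]
  exact (mul_eq_zero.1 key).resolve_right hj₀

theorem eval_rep_eq_zero_of_aeval_eq_zero (he : 0 < e) (hF : ∀ j, (F j).IsHomogeneous e)
    {x : ℙ K (κ → K)} (hx : x ∈ closedImage F) {q : MvPolynomial κ K} (hq : aeval F q = 0) :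
    eval x.rep q = 0 := by
  rw [← sum_homogeneousComponent q, map_sum]
  refine Finset.sum_eq_zero fun i _ => ?_
  have h0 := aeval_homogeneousComponent_eq_zero he hF hq i
  refine hx i _ (homogeneousComponent_isHomogeneous i q) ?_
  rintro _ ⟨P, hP, rfl⟩
  obtain ⟨b, hb⟩ := Projectivization.exists_smul_eq_mk_rep K _ hP
  rw [← hb, Units.smul_def, eval_smul_of_isHomogeneous (homogeneousComponent_isHomogeneous i q),
    ← eval_aeval_eq, h0, map_zero, mul_zero]

theorem homogeneousIdeal_closedImage [Infinite K] (he : 0 < e) (hF : ∀ j, (F j).IsHomogeneous e)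
    {j₀ : κ} (hj₀ : F j₀ ≠ 0) : homogeneousIdeal (closedImage F) =
      RingHom.ker (aeval F : MvPolynomial κ K →ₐ[K] MvPolynomial (Fin (n + 1)) K) := by
  refine le_antisymm (Ideal.span_le.2 ?_) fun q hq => ?_
  · rintro g ⟨⟨m, hm⟩, hg⟩
    exact (RingHom.mem_ker).2 (aeval_eq_zero_of_vanish_closedImage he hF hj₀ hm hg)
  · rw [← sum_homogeneousComponent q]
    refine sum_mem fun i _ => Ideal.subset_span
      ⟨⟨i, homogeneousComponent_isHomogeneous i q⟩, fun x hx => ?_⟩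
    exact eval_rep_eq_zero_of_aeval_eq_zero he hF hx
      (aeval_homogeneousComponent_eq_zero he hF ((RingHom.mem_ker).1 hq) i)

/-- Scaling invariance of the condition that a linear form vanishes to order `N` on a cone. -/
theorem linear_mem_sup_smul (he : 0 < e) (hF : ∀ j, (F j).IsHomogeneous e) {v : κ → K} {c : K}
    (hc : c ≠ 0) {N : ℕ} {l : MvPolynomial κ K} (hl : l.IsHomogeneous 1)
    (h : l ∈ RingHom.ker (aeval F : MvPolynomial κ K →ₐ[K] MvPolynomial (Fin (n + 1)) K) ⊔
      RingHom.ker (eval v) ^ N) :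
    l ∈ RingHom.ker (aeval F : MvPolynomial κ K →ₐ[K] MvPolynomial (Fin (n + 1)) K) ⊔
      RingHom.ker (eval (c • v)) ^ N := by
  -- This substitution carries the ideal of `v` into that of `c • v`, preserves the homogeneous
  -- kernel, and multiplies the linear form `l` by `c⁻¹`.
  set s : MvPolynomial κ K →ₐ[K] MvPolynomial κ K := aeval fun j => C c⁻¹ * X j with hs
  have hsm : ∀ {m : ℕ} {g : MvPolynomial κ K}, g.IsHomogeneous m → s g = C (c⁻¹ ^ m) * g := by
    intro m g hg
    refine isHomogeneous_induction (p := fun g => s g = C (c⁻¹ ^ m) * g) (by simp)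
      (fun a b ha hb => by rw [map_add, ha, hb, mul_add]) (fun t r ht => ?_) hg
    rw [hs, aeval_monomial, Finsupp.prod]
    simp only [mul_pow, Finset.prod_mul_distrib, ← C_pow]
    rw [← map_prod, Finset.prod_pow_eq_pow_sum, ← Finsupp.degree_apply, ht, mul_left_comm,
      monomial_eq, Finsupp.prod, algebraMap_eq]
  have hker : ∀ g : MvPolynomial κ K, aeval F g = 0 → aeval F (s g) = 0 := by
    intro g hg
    conv_lhs => rw [← sum_homogeneousComponent g, map_sum, map_sum]
    refine Finset.sum_eq_zero fun i _ => ?_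
    rw [hsm (homogeneousComponent_isHomogeneous i g), map_mul,
      aeval_homogeneousComponent_eq_zero he hF hg, mul_zero]
  obtain ⟨u, hu, w, hw, huw⟩ := Submodule.mem_sup.1 h
  have hw' : s w ∈ RingHom.ker (eval (c • v)) ^ N :=
    map_mem_pow s.toRingHom (algHom_mem_ker_eval s fun j => by
      simp [hs, RingHom.mem_ker, inv_mul_cancel_left₀ hc]) hw
  have h1 : C (c⁻¹) * l = s u + s w := by
    rw [← map_add, huw, hsm hl, pow_one]
  have h2 : l = C c * (s u + s w) := by
    rw [← h1, ← mul_assoc, ← C_mul, mul_inv_cancel₀ hc, C_1, one_mul]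
  rw [h2]
  exact Ideal.mul_mem_left _ _ (add_mem (Ideal.mem_sup_left ((RingHom.mem_ker).2
    (hker u ((RingHom.mem_ker).1 hu)))) (Ideal.mem_sup_right hw'))

theorem finrank_osculatingSpace_eq_iff [Fintype κ] (S : Set (ℙ K (κ → K))) (s : ℕ)
    (x : ℙ K (κ → K)) :
    Module.finrank K (osculatingSpace S s x) = Fintype.card κ ↔ ∀ a : κ → K,
      ∑ j, C (a j) * X j ∈ homogeneousIdeal S ⊔ RingHom.ker (eval x.rep) ^ (s + 1) → a = 0 := by
  classical
  rw [← Module.finrank_fintype_fun_eq_card K]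
  constructor
  · intro h a ha
    have htop := Submodule.eq_top_of_finrank_eq h
    funext i
    have hmem : (Pi.single i 1 : κ → K) ∈ osculatingSpace S s x := by rw [htop]; trivial
    simpa [Pi.single_apply] using hmem a ha
  · intro h
    have htop : osculatingSpace S s x = ⊤ := by
      rw [eq_top_iff]
      intro v _ a ha
      rw [h a ha]; simp
    rw [htop, finrank_top]

end ClosedImage

/-! ### Osculating spaces of the polar varieties -/

section Osculating

variable {K : Type*} [Field K] {n : ℕ}

theorem monomialOp_mem_pow (I : Ideal (MvPolynomial (Fin (n + 1)) K)) (m : Fin (n + 1) →₀ ℕ) :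
    ∀ (s : ℕ) (g : MvPolynomial (Fin (n + 1)) K), g ∈ I ^ (s + m.degree) →
      monomialOp K m g ∈ I ^ s := by
  induction m using monomialOp_induction with
  | h0 => intro s g hg; simpa [monomialOp_zero] using hg
  | h1 i =>
    intro s g hg
    rw [monomialOp_single_one]
    rw [Finsupp.degree_single] at hg
    exact derivation_mem_pow (pderiv i) I s hg
  | hadd a b ha hb =>
    intro s g hg
    rw [monomialOp_add, Module.End.mul_apply]
    refine ha s _ (hb _ g ?_)
    rwa [add_assoc, ← map_add]

theorem eval_diffOp_eq_zero_of_mem_pow {P : Fin (n + 1) → K} {k : ℕ}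
    {g β : MvPolynomial (Fin (n + 1)) K} (hg : g ∈ RingHom.ker (eval P) ^ (k + 1))
    (hβ : β.IsHomogeneous k) : eval P (diffOp β g) = 0 := by
  refine isHomogeneous_induction (p := fun β => eval P (diffOp β g) = 0) (by simp)
    (fun a b ha hb => by rw [map_add, LinearMap.add_apply, map_add, ha, hb, add_zero])
    (fun m c hm => ?_) hβ
  have := monomialOp_mem_pow (RingHom.ker (eval P)) m 1 g (by rwa [hm, add_comm 1 k])
  rw [pow_one, RingHom.mem_ker] at this
  rw [diffOp_monomial, LinearMap.smul_apply, smul_eval, this, mul_zero]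

/-- A form of degree at least `k` all of whose derivatives of order `k` vanish at `P` vanishes at
`P` to order `k + 1`. -/
theorem mem_pow_of_eval_diffOp_eq_zero [CharZero K] {P : Fin (n + 1) → K} {k e : ℕ} (hke : k ≤ e)
    {g : MvPolynomial (Fin (n + 1)) K} (hg : g.IsHomogeneous e)
    (h : ∀ β : MvPolynomial (Fin (n + 1)) K, β.IsHomogeneous k → eval P (diffOp β g) = 0) :
    g ∈ RingHom.ker (eval P) ^ (k + 1) := by
  induction k generalizing e g with
  | zero =>
    have := h 1 (isHomogeneous_one _ _)
    rw [zero_add, pow_one, RingHom.mem_ker]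
    simpa using this
  | succ k ih =>
    have h1 : ∀ i, pderiv i g ∈ RingHom.ker (eval P) ^ (k + 1) := fun i =>
      ih (e := e - 1) (by omega) hg.pderiv fun β hβ => by
        rw [← diffOp_X, ← diffOp_mul]
        exact h _ (hβ.mul (isHomogeneous_X K i))
    refine mem_pow_succ_of_pderiv_mem P (k + 1) ?_ h1
    -- Euler's identity recovers `g(P)` from the first derivatives; the degree `e` is nonzero
    -- because `k + 1 ≤ e`.
    have h2 := IsHomogeneous.sum_mul_eval_pderiv hg P
    rw [Finset.sum_eq_zero fun i _ => by
      rw [(RingHom.mem_ker).1 (Ideal.pow_le_self (Nat.succ_ne_zero k) (h1 i)), mul_zero]] at h2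
    refine (mul_eq_zero.1 h2.symm).resolve_left (Nat.cast_ne_zero.2 (by omega))

theorem diffOp_mem_inverseSystem {f : MvPolynomial (Fin (n + 1)) K} {d : ℕ}
    (hf : f.IsHomogeneous d) {k : ℕ}
    {γ : MvPolynomial (Fin (n + 1)) K} (hγ : γ.IsHomogeneous k) :
    diffOp γ f ∈ inverseSystem (Ann f) (d - k) :=
  ⟨diffOp_isHomogeneous hγ hf rfl, fun α hα => by
    rw [← diffOp_mul, mul_comm, diffOp_mul, mem_Ann.1 hα, map_zero]⟩

theorem aeval_sum_C_mul_X {κ : Type*} [Fintype κ] (F : κ → MvPolynomial (Fin (n + 1)) K)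
    (a : κ → K) : aeval F (∑ j, C (a j) * X j) = ∑ j, a j • F j := by
  rw [map_sum]
  refine Finset.sum_congr rfl fun j _ => ?_
  rw [map_mul, aeval_X, ← algebraMap_eq, AlgHom.commutes, Algebra.smul_def]

theorem sum_C_mul_X_isHomogeneous {κ : Type*} [Fintype κ] (a : κ → K) :
    (∑ j, C (a j) * X j : MvPolynomial κ K).IsHomogeneous 1 :=
  IsHomogeneous.sum _ _ _ fun j _ => by
    simpa using (isHomogeneous_C _ (a j)).mul (isHomogeneous_X K j)

variable [CharZero K] {f : MvPolynomial (Fin (n + 1)) K} {d : ℕ}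

/-- The inverse system of `Ann_f` consists of the partial derivatives of `f`. -/
theorem mem_inverseSystem_iff (hf : f.IsHomogeneous d) {k : ℕ} (hk : k ≤ d)
    {g : MvPolynomial (Fin (n + 1)) K} : g ∈ inverseSystem (Ann f) (d - k) ↔
      ∃ γ : MvPolynomial (Fin (n + 1)) K, γ.IsHomogeneous k ∧ diffOp γ f = g := by
  constructor
  · rintro ⟨hg, hann⟩
    by_contra hc
    have hW : g ∉ (homogeneousSubmodule (Fin (n + 1)) K k).map
        (diffOp.toLinearMap.flip f) := hc
    -- A functional separating `g` from the derivatives of `f` is an operator `α` of order `d - k`.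
    -- It annihilates `f`, because all order-`k` operators kill `α(f)`, yet `α(g) ≠ 0`.
    obtain ⟨l, hlg, hl⟩ := Submodule.exists_le_ker_of_notMem hW
    obtain ⟨α, hα, hαl⟩ := exists_diffOp_eq_C l (d - k)
    have hαf : diffOp α f = 0 := by
      refine eq_zero_of_diffOp_eq_zero (k := k)
        (diffOp_isHomogeneous hα hf (by omega)) fun β hβ => ?_
      have h0 : l (diffOp β f) = 0 := hl ⟨β, hβ, rfl⟩
      rw [← diffOp_mul, mul_comm, diffOp_mul, hαl _ (diffOp_isHomogeneous hβ hf rfl), h0, C_0]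
    have h1 := hann α hαf
    rw [hαl g hg, C_eq_zero] at h1
    exact hlg h1
  · rintro ⟨γ, hγ, rfl⟩
    exact diffOp_mem_inverseSystem hf hγ

theorem finrank_inverseSystem_le (hf : f.IsHomogeneous d) {k : ℕ} (hk : k ≤ d) :
    Module.finrank K (inverseSystem (Ann f) (d - k)) ≤ (n + k).choose k := by
  have h : inverseSystem (Ann f) (d - k) =
      (homogeneousSubmodule (Fin (n + 1)) K k).map (diffOp.toLinearMap.flip f) := by
    ext g; exact mem_inverseSystem_iff hf hk
  rw [h]
  exact (Submodule.finrank_map_le _ _).trans (finrank_homogeneousSubmodule_le k)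

theorem exists_mem_inverseSystem_ne_zero (hf : f.IsHomogeneous d) (hf0 : f ≠ 0) {k : ℕ}
    (hk : k ≤ d) : ∃ g ∈ inverseSystem (Ann f) (d - k), g ≠ 0 := by
  obtain ⟨P, hP⟩ := exists_eval_ne_zero hf0
  have hpow : (linForm P ^ k).IsHomogeneous k := by
    simpa using (linForm_isHomogeneous P).pow k
  refine ⟨_, diffOp_mem_inverseSystem hf hpow, fun h0 => ?_⟩
  have h1 := diffOp_linForm_pow P hf
  rw [show d = d - k + k by omega, pow_add, diffOp_mul, h0, map_zero, eq_comm, C_eq_zero] at h1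
  exact hP ((mul_eq_zero.1 h1).resolve_left (Nat.cast_ne_zero.2 (Nat.factorial_ne_zero _)))

/-- The Hessian is nondegenerate at `P` if and only if no hyperplane section of the polar map
vanishes to order `k + 1` at `P`. -/
theorem hessNondegenerate_iff_pullback (hf : f.IsHomogeneous d) {k : ℕ} (hk : 2 * k ≤ d)
    {κ : Type*} [Fintype κ] (F : Module.Basis κ K (inverseSystem (Ann f) (d - k)))
    (P : Fin (n + 1) → K) :
    HessNondegenerate f k P ↔ ∀ a : κ → K,
      aeval (fun j => (F j : MvPolynomial (Fin (n + 1)) K)) (∑ j, C (a j) * X j) ∈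
        RingHom.ker (eval P) ^ (k + 1) → a = 0 := by
  have hsum : ∀ a : κ → K, aeval (fun j => (F j : MvPolynomial (Fin (n + 1)) K))
      (∑ j, C (a j) * X j) = ((∑ j, a j • F j : inverseSystem (Ann f) (d - k)) : _) := by
    intro a
    rw [aeval_sum_C_mul_X, Submodule.coe_sum]; rfl
  have hzero : ∀ a : κ → K, (∑ j, a j • F j : inverseSystem (Ann f) (d - k)) = 0 → a = 0 :=
    fun a ha => _root_.funext (Fintype.linearIndependent_iff.1 F.linearIndependent a ha)
  constructor
  · intro h a ha
    rw [hsum] at ha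
    apply hzero
    obtain ⟨γ, hγ, hγg⟩ := (mem_inverseSystem_iff hf (by omega)).1
      (∑ j, a j • F j : inverseSystem (Ann f) (d - k)).2
    have h1 := h _ (mk_mem_gradedPiece (Ann f) hγ) fun b hb => by
      obtain ⟨β, hβ, rfl⟩ := mem_gradedPiece.1 hb
      rw [← map_mul, applyHom_mk, diffOp_mul, hγg]
      exact eval_diffOp_eq_zero_of_mem_pow ha hβ
    rw [Ideal.Quotient.eq_zero_iff_mem, mem_Ann, hγg] at h1
    exact Subtype.ext h1
  · intro h b hb hann
    obtain ⟨γ, hγ, rfl⟩ := mem_gradedPiece.1 hb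
    rw [Ideal.Quotient.eq_zero_iff_mem, mem_Ann]
    have hmem := diffOp_mem_inverseSystem hf hγ
    have hrepr := F.sum_repr ⟨_, hmem⟩
    have h1 := h (F.repr ⟨_, hmem⟩) (by
      rw [hsum, hrepr]
      refine mem_pow_of_eval_diffOp_eq_zero (e := d - k) (by omega) hmem.1 fun β hβ => ?_
      have := hann _ (mk_mem_gradedPiece (Ann f) hβ)
      rwa [← map_mul, applyHom_mk, diffOp_mul] at this)
    have h2 : (⟨_, hmem⟩ : inverseSystem (Ann f) (d - k)) = 0 := by
      rw [← hrepr, h1]; simp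
    exact congrArg Subtype.val h2

/-- The osculating space of order `k` of the `(d - k)`-th polar variety has the expected dimension
if and only if the `k`-th Hessian is nonzero. -/
theorem hasExpectedOsculatingDim_iff [IsAlgClosed K] (hf : f.IsHomogeneous d) (hf0 : f ≠ 0) {k : ℕ}
    (hk : 2 * k < d) {ι : Type*} [Fintype ι] [DecidableEq ι]
    (α : Module.Basis ι K (gradedPiece (Ann f) k))
    (F : Module.Basis (Fin (Module.finrank K (inverseSystem (Ann f) (d - k)))) K
      (inverseSystem (Ann f) (d - k))) :
    HasExpectedOsculatingDim (fun j => (F j : MvPolynomial (Fin (n + 1)) K)) k ↔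
      hess f α ≠ 0 := by
  set G : Fin (Module.finrank K (inverseSystem (Ann f) (d - k))) → MvPolynomial (Fin (n + 1)) K :=
    fun j => F j with hG
  have he : 0 < d - k := by omega
  have hhom : ∀ j, (G j).IsHomogeneous (d - k) := fun j => (F j).2.1
  obtain ⟨g₀, hg₀, hg₀0⟩ := exists_mem_inverseSystem_ne_zero hf hf0 (show k ≤ d by omega)
  obtain ⟨j₀⟩ : Nonempty (Fin (Module.finrank K (inverseSystem (Ann f) (d - k)))) := by
    by_contra hemp
    rw [not_nonempty_iff] at hemp
    have hrepr := F.sum_repr ⟨g₀, hg₀⟩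
    rw [Finset.univ_eq_empty, Finset.sum_empty] at hrepr
    exact hg₀0 (congrArg Subtype.val hrepr.symm)
  have hj₀ : G j₀ ≠ 0 := fun h0 => F.ne_zero j₀ (Subtype.ext h0)
  -- The minimum is always attained by the ambient space, since order-`k` derivatives of `f` span at
  -- most `binom(n+k, k)` dimensions.
  have hdim : expectedDim n k (Module.finrank K (inverseSystem (Ann f) (d - k)) - 1) + 1 =
      Fintype.card (Fin (Module.finrank K (inverseSystem (Ann f) (d - k)))) := by
    have h1 := finrank_inverseSystem_le hf (show k ≤ d by omega)
    have h2 := j₀.pos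
    rw [Fintype.card_fin, expectedDim, min_eq_right (by omega)]
    omega
  unfold HasExpectedOsculatingDim
  rw [hdim]
  simp only [finrank_osculatingSpace_eq_iff, homogeneousIdeal_closedImage he hhom hj₀]
  constructor
  · rintro ⟨e, g, hg, ⟨x, hx, hxg⟩, hgen⟩
    obtain ⟨δ, hδ, hδP⟩ := exists_mem_sup_of_pullback_mem_pow G
    have hg0 : aeval G g ≠ 0 := fun h0 =>
      hxg (eval_rep_eq_zero_of_aeval_eq_zero he hhom hx h0)
    -- The three factors ensure that the image of `P` is a general point, that orders of vanishing
    -- descend from `P`, and that `P` is not a base point.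
    obtain ⟨P, hP⟩ := exists_eval_ne_zero (mul_ne_zero (mul_ne_zero hg0 hδ) hj₀)
    rw [map_mul, map_mul] at hP
    have hPg := left_ne_zero_of_mul (left_ne_zero_of_mul hP)
    rw [eval_aeval_eq] at hPg
    have hne : (fun j => eval P (G j)) ≠ 0 := fun h0 =>
      right_ne_zero_of_mul hP (congrFun h0 j₀)
    obtain ⟨b, hb⟩ := Projectivization.exists_smul_eq_mk_rep K _ hne
    have h1 := hgen _ (mk_mem_closedImage he hhom hne) (by
      rw [← hb, Units.smul_def, eval_smul_of_isHomogeneous hg]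
      exact mul_ne_zero (pow_ne_zero _ b.ne_zero) hPg)
    have h2 : HessNondegenerate f k P :=
      (hessNondegenerate_iff_pullback hf hk.le F P).2 fun a ha => h1 a (by
        rw [← hb]
        exact linear_mem_sup_smul he hhom b.ne_zero (sum_C_mul_X_isHomogeneous a)
          (hδP P (right_ne_zero_of_mul (left_ne_zero_of_mul hP)) _ _ ha))
    intro h0
    exact (eval_hess_ne_zero_iff f α P).2 h2 (by rw [h0, map_zero])
  · intro hhess
    obtain ⟨g, hg, hlift⟩ := exists_lift_point G hhess
    -- Chevalley's open set lives on the affine cone and `g` need not be a form. Where a component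
    -- with nonzero pullback does not vanish, some nonzero multiple of the representative lies in
    -- that open set.
    obtain ⟨m, hm⟩ : ∃ m, aeval G (homogeneousComponent m g) ≠ 0 := by
      by_contra! h
      apply hg
      rw [← sum_homogeneousComponent g, map_sum]
      exact Finset.sum_eq_zero fun i _ => h i
    have hmhom := homogeneousComponent_isHomogeneous m g
    refine ⟨m, homogeneousComponent m g, hmhom, ?_, fun x hx hxg a ha => ?_⟩
    · by_contra! h
      exact hm (aeval_eq_zero_of_vanish_closedImage he hhom hj₀ hmhom h)
    · obtain ⟨c, hc, hcg⟩ := exists_ne_zero_eval_smul_ne_zero hxg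
      obtain ⟨P, hPx, hPhess⟩ := hlift (c • x.rep) (fun q hq => by
        rw [← sum_homogeneousComponent q, map_sum]
        refine Finset.sum_eq_zero fun i _ => ?_
        rw [eval_smul_of_isHomogeneous (homogeneousComponent_isHomogeneous i q),
          eval_rep_eq_zero_of_aeval_eq_zero he hhom hx
            (aeval_homogeneousComponent_eq_zero he hhom hq i), mul_zero]) hcg
      refine (hessNondegenerate_iff_pullback hf hk.le F P).1
        ((eval_hess_ne_zero_iff f α P).1 hPhess) a ?_
      have h1 := linear_mem_sup_smul he hhom hc (sum_C_mul_X_isHomogeneous a) ha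
      obtain ⟨u, hu, w, hw, huw⟩ := Submodule.mem_sup.1 h1
      rw [← huw, map_add]
      change aeval G u + aeval G w ∈ _
      rw [(RingHom.mem_ker).1 hu, zero_add]
      exact map_mem_pow (aeval G : _ →ₐ[K] MvPolynomial (Fin (n + 1)) K).toRingHom
        (algHom_mem_ker_eval _ fun j => by
          rw [RingHom.mem_ker, eval_aeval_eq]
          simp only [map_sub, eval_X, eval_C]
          rw [hPx j, sub_self]) hw

end Osculating

end Apolar

end

/-! ### The equivalence of the three conditions -/

theorem mainTheorem6 {K : Type*} [Field K] [IsAlgClosed K] [CharZero K] (n d : ℕ)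
    (f : MvPolynomial (Fin (n + 1)) K) (hf : f.IsHomogeneous d) (hf0 : f ≠ 0)
    (α : ∀ k : ℕ, Module.Basis (Fin (Module.finrank K (Apolar.gradedPiece (Apolar.Ann f) k))) K
      (Apolar.gradedPiece (Apolar.Ann f) k))
    (F : ∀ k : ℕ, Module.Basis (Fin (Module.finrank K (Apolar.inverseSystem (Apolar.Ann f) k))) K
      (Apolar.inverseSystem (Apolar.Ann f) k)) :
    List.TFAE
      [Apolar.HasSLP (Apolar.Ann f),
        ∀ k : ℕ, 2 * k ≤ d → Apolar.hess f (α k) ≠ 0,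
        ∀ k : ℕ, 0 < k → 2 * k < d →
          Apolar.HasExpectedOsculatingDim
            (fun j => (F (d - k) j : MvPolynomial (Fin (n + 1)) K)) k] := by
  tfae_have 1 ↔ 2 :=
    (Apolar.hasSLP_iff hf).trans (Apolar.exists_forall_hessNondegenerate_iff α)
  tfae_have 2 → 3 := fun h k _ hk =>
    (Apolar.hasExpectedOsculatingDim_iff hf hf0 hk (α k) (F (d - k))).2 (h k hk.le)
  tfae_have 3 → 2 := by
    intro h k hk h0
    -- The osculating condition omits `2k = d` and `k = 0`. Both Hessians are nonzero anyway: the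
    -- first by duality in the middle degree, the second because it is a nonzero multiple of `f`
    -- when `A_0` is spanned by the class of `1`.
    rcases hk.eq_or_lt with heq | hlt
    · exact (Apolar.eval_hess_ne_zero_iff f (α k) 0).2
        (Apolar.hessNondegenerate_half hf heq 0) (by rw [h0, map_zero])
    rcases Nat.eq_zero_or_pos k with rfl | hpos
    · obtain ⟨P, hP⟩ := Apolar.exists_eval_ne_zero hf0
      exact (Apolar.eval_hess_ne_zero_iff f (α 0) P).2
        (Apolar.hessNondegenerate_zero hP) (by rw [h0, map_zero])
    · exact (Apolar.hasExpectedOsculatingDim_iff hf hf0 hlt (α k) (F (d - k))).1 (h k hpos hlt) h0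
  tfae_finish
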